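/- Let $\mathbb T=\mathbb R/\mathbb Z$ be the flat one-dimensional torus. Let $W:\mathbb R\to\mathbb R$ be convex with linear growth, i.e. the limits $W^+=\lim_{t\to\infty}W(t)/t$ and $W^-=\lim_{t\to\infty}W(-t)/t$ exist and are (finite) positive numbers. Let $f\in W^{1,1}(\mathbb T)$ and $h>0$. Call $u\in W^{1,1}(\mathbb T)$ a weak solution of $$\frac1h(u-f)=(W_p(u_x))_x\quad\text{in }\mathbb T$$ if there exists $\xi\in L^\infty(\mathbb T)$ with weak derivative $\xi_x\in L^2(\mathbb T)$ such that $\xi(x)\in\partial W(u_x(x))$ for a.e. $x\in\mathbb T$, where $\partial W(p)=\{\omega\in\mathbb R:\ W(q)\ge W(p)+\omega(q-p)\ \text{for all } q\in\mathbb R\}$, and $$\int_{\mathbb T}\Big(\frac1h(u-f)\varphi+\xi\varphi_x\Big)\,dx=0\qquad\text{for all }\varphi\in C^\infty(\mathbb T).$$ Then there exists a unique weak solution $u\in W^{1,1}(\mathbb T)$. Moreover, there are smooth convex functions $\Phi:\mathbb R\to\mathbb R$ with $\lim_{|p|\to\infty}\Phi(p)/|p|=\infty$ and $\int_{\mathbb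 T}\Phi(f_x)\,dx<\infty$, and for every such $\Phi$ the function $\Phi(u_x)$ is integrable and $$\int_{\mathbb T}\Phi(u_x)\,dx\le\int_{\mathbb T}\Phi(f_x)\,dx .$$ -/

import Mathlib

open MeasureTheory Filter Topology
open scoped ContDiff

/-- `φ ∈ C^∞(𝕋)`, where `𝕋 = ℝ / ℤ`: the `1`-periodic function on `ℝ` induced by `φ` is smooth. -/
def IsTorusSmooth (φ : UnitAddCircle → ℝ) : Prop :=
  ContDiff ℝ ∞ (fun t : ℝ => φ (t : UnitAddCircle))

/-- The classical derivative `φ_x` of a function on the torus. -/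
noncomputable def torusDeriv (φ : UnitAddCircle → ℝ) (x : UnitAddCircle) : ℝ :=
  deriv (fun t : ℝ => φ (x + (t : UnitAddCircle))) 0

/-- `g` is a weak (distributional) derivative of `u` on the torus. It is used below only for
integrable `u` and `g`. -/
def HasWeakDeriv (u g : UnitAddCircle → ℝ) : Prop :=
  ∀ φ : UnitAddCircle → ℝ, IsTorusSmooth φ →
    ∫ x, u x * torusDeriv φ x = - ∫ x, g x * φ x

/-- `u ∈ W^{1,1}(𝕋)`, with weak derivative (a representative of) `ux`. -/
structure IsW11 (u ux : UnitAddCircle → ℝ) : Prop where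
  integrable : Integrable u
  integrable_deriv : Integrable ux
  hasWeakDeriv : HasWeakDeriv u ux

/-- The subdifferential `∂W(p)` of a (convex) function `W : ℝ → ℝ` at `p`. -/
def subdifferential (W : ℝ → ℝ) (p : ℝ) : Set ℝ :=
  {s | ∀ q, W p + s * (q - p) ≤ W q}

/-- Linear growth at infinity:
`lim_{t → ∞} W(t) / t` and `lim_{t → ∞} W(-t) / t` exist and are (finite) positive numbers. -/
def HasLinearGrowth (W : ℝ → ℝ) : Prop :=
  ∃ Wplus Wminus : ℝ, 0 < Wplus ∧ 0 < Wminus ∧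
    Tendsto (fun t => W t / t) atTop (𝓝 Wplus) ∧
    Tendsto (fun t => W (-t) / t) atTop (𝓝 Wminus)

/-- `u ∈ W^{1,1}(𝕋)`, with weak derivative `ux`, is a weak solution of
`(u - f) / h = (W_p(u_x))_x` on the torus. -/
structure IsWeakSolution (W : ℝ → ℝ) (h : ℝ) (f u ux : UnitAddCircle → ℝ) : Prop where
  isW11 : IsW11 u ux
  exists_flux : ∃ ξ ξx : UnitAddCircle → ℝ,
    MemLp ξ ⊤ ∧ MemLp ξx 2 ∧ HasWeakDeriv ξ ξx ∧
    (∀ᵐ x, ξ x ∈ subdifferential W (ux x)) ∧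
    ∀ φ : UnitAddCircle → ℝ, IsTorusSmooth φ →
      ∫ x, ((1 / h) * (u x - f x) * φ x + ξ x * torusDeriv φ x) = 0

/-- `Φ : ℝ → ℝ` is smooth, convex, superlinear (`Φ(p) / |p| → ∞` as `|p| → ∞`), and
`∫ Φ(g) < ∞`. -/
structure IsSuperlinearFor (Φ : ℝ → ℝ) (g : UnitAddCircle → ℝ) : Prop where
  smooth : ContDiff ℝ ∞ Φ
  convex : ConvexOn ℝ Set.univ Φ
  superlinear : Tendsto (fun p => Φ p / |p|) (cocompact ℝ) atTop
  integrable : Integrable (fun x => Φ (g x))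

/-! Write `p = u_x`, `g = f_x` and `β` for a subgradient of `W`. Linear growth alone bounds `p` only
in `L¹`, so weak limits could be singular measures. What rules this out is the differentiated
equation `p - g = h (β(p))_xx`: since `-(β(·))_xx` is accretive in `L¹`, comparison with a constant
slope `c` gives `∫|p - c| ≤ ∫|g - c|`, and comparison with a translate gives `∫|p(·+s) - p| ≤
∫|g(·+s) - g|`. Both follow from `integral_abs_le_of_sign`.

For existence, `β` is replaced by a symmetric difference quotient of `W` plus `ε p`, a strictly
increasing Lipschitz function. The regularized problem is a first-order periodic system for `u` and
the flux `ξ`, solved by the contraction principle (`exists_periodic_system`). The bound `|u - F| ≤ 2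
∫|g|`, with `F` the continuous representative of `f`, makes the fluxes equi-Lipschitz, so along a
sequence `ε → 0` they converge uniformly. Integration by parts makes the `u` Cauchy in `L¹`
(`integral_sq_sub_le`). The translation estimate makes each slope close to a difference quotient of
`u`, uniformly in `ε`, hence the slopes are Cauchy in `L¹` (`integral_abs_slope_sub_le`). Strong
convergence lets the subgradient inequality pass to the limit almost everywhere (`exists_solution`).

Uniqueness is monotonicity of the subdifferential (`IsWeakSolution.ae_eq`). The estimate for `Φ` is
convex ordering: `u_x` and `f_x` both have mean zero, and up to an affine function a smooth convex
`Φ` is a positive superposition of functions built from `|x - k|`, so the inequalities for constants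
suffice (`integral_convex_comp_le`). The existence of `Φ` is the de la Vallée-Poussin construction
(`exists_isSuperlinearFor`). -/

/-! ### Primitives and integration by parts -/

/-- `G` is a primitive of the locally integrable function `g`. -/
structure IsPrimitive (G g : ℝ → ℝ) : Prop where
  intervalIntegrable : ∀ a b, IntervalIntegrable g volume a b
  integral_eq : ∀ a b, ∫ x in a..b, g x = G b - G a

namespace IsPrimitive

variable {G g H k : ℝ → ℝ}

lemma of_hasDerivAt (hd : ∀ x, HasDerivAt G (g x) x) (hg : Continuous g) : IsPrimitive G g :=
  ⟨fun a b => hg.intervalIntegrable a b, fun a b =>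
    intervalIntegral.integral_eq_sub_of_hasDerivAt (fun x _ => hd x) (hg.intervalIntegrable a b)⟩

lemma of_integral (hg : ∀ a b, IntervalIntegrable g volume a b) (c : ℝ) :
    IsPrimitive (fun x => c + ∫ t in (0 : ℝ)..x, g t) g :=
  ⟨hg, fun a b => by
    rw [← intervalIntegral.integral_interval_sub_left (hg 0 b) (hg 0 a)]; ring⟩

lemma eq_add_integral (hG : IsPrimitive G g) (a : ℝ) : G = fun x => G a + ∫ t in a..x, g t := by
  funext x; rw [hG.integral_eq]; ring

lemma absolutelyContinuousOnInterval (hG : IsPrimitive G g) (a b : ℝ) :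
    AbsolutelyContinuousOnInterval G a b := by
  have h1 := (hG.intervalIntegrable a b).absolutelyContinuousOnInterval_intervalIntegral
    (c := a) (by simp)
  have h2 : AbsolutelyContinuousOnInterval (fun _ : ℝ => G a) a b :=
    (LipschitzWith.const (G a)).lipschitzOnWith.absolutelyContinuousOnInterval
  rw [hG.eq_add_integral a]
  exact h2.fun_add h1

lemma continuous (hG : IsPrimitive G g) : Continuous G := by
  rw [hG.eq_add_integral 0]
  exact continuous_const.add (intervalIntegral.continuous_primitive hG.intervalIntegrable 0)

lemma ae_hasDerivAt (hG : IsPrimitive G g) (a b : ℝ) :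
    ∀ᵐ x, x ∈ Set.uIcc a b → HasDerivAt G (g x) x := by
  filter_upwards [(hG.intervalIntegrable a b).ae_hasDerivAt_integral] with x hx hxab
  have := (hx hxab a (by simp)).const_add (G a)
  rwa [← hG.eq_add_integral a] at this

/-- Integration by parts. -/
lemma integral_mul_add_mul (hG : IsPrimitive G g) (hH : IsPrimitive H k) (a b : ℝ) :
    ∫ x in a..b, (g x * H x + G x * k x) = G b * H b - G a * H a := by
  rw [← (hG.absolutelyContinuousOnInterval a b).integral_deriv_mul_eq_sub
    (hH.absolutelyContinuousOnInterval a b)]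
  apply intervalIntegral.integral_congr_ae
  filter_upwards [hG.ae_hasDerivAt a b, hH.ae_hasDerivAt a b] with x h1 h2 hx
  have hx' := Set.uIoc_subset_uIcc hx
  rw [(h1 hx').deriv, (h2 hx').deriv]

lemma integral_mul_eq_neg (hG : IsPrimitive G g) (hH : IsPrimitive H k)
    (hGp : Function.Periodic G 1) (hHp : Function.Periodic H 1) :
    ∫ x in (0 : ℝ)..1, g x * H x = - ∫ x in (0 : ℝ)..1, G x * k x := by
  have h := hG.integral_mul_add_mul hH 0 1
  rw [intervalIntegral.integral_add] at h
  · have h1 := hGp 0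
    have h2 := hHp 0
    rw [zero_add] at h1 h2
    rw [h1, h2] at h
    linarith
  · exact (hG.intervalIntegrable 0 1).mul_continuousOn hH.continuous.continuousOn
  · exact (hH.intervalIntegrable 0 1).continuousOn_mul hG.continuous.continuousOn

lemma sub (hG : IsPrimitive G g) (hH : IsPrimitive H k) :
    IsPrimitive (fun x => G x - H x) (fun x => g x - k x) :=
  ⟨fun a b => (hG.intervalIntegrable a b).sub (hH.intervalIntegrable a b), fun a b => by
    rw [intervalIntegral.integral_sub (hG.intervalIntegrable a b) (hH.intervalIntegrable a b),
      hG.integral_eq, hH.integral_eq]; ring⟩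

lemma comp_add (hG : IsPrimitive G g) (s : ℝ) :
    IsPrimitive (fun x => G (x + s)) (fun x => g (x + s)) :=
  ⟨fun a b => by
    have := (hG.intervalIntegrable (a + s) (b + s)).comp_add_right s
    simpa using this, fun a b => by
    rw [intervalIntegral.integral_comp_add_right (fun x => g x), hG.integral_eq]⟩

end IsPrimitive

/-! ### Functions on the circle and their weak derivatives -/

lemma torus_integral_eq (v : UnitAddCircle → ℝ) : ∫ x, v x = ∫ t in (0 : ℝ)..1, v t := by
  have := UnitAddCircle.intervalIntegral_preimage 0 v
  rw [zero_add] at this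
  exact this.symm

lemma periodic_comp_coe {α : Type*} (v : UnitAddCircle → α) :
    Function.Periodic (fun t : ℝ => v t) 1 := fun t => by
  simp only [AddCircle.coe_add, AddCircle.coe_period, add_zero]

lemma measurePreserving_coe_Ioc :
    MeasurePreserving ((↑) : ℝ → UnitAddCircle) (volume.restrict (Set.Ioc 0 1)) := by
  have := UnitAddCircle.measurePreserving_mk 0
  rwa [zero_add] at this

lemma MeasureTheory.Integrable.intervalIntegrable_coe {v : UnitAddCircle → ℝ}
    (hv : Integrable v) (a b : ℝ) :
    IntervalIntegrable (fun t : ℝ => v t) volume a b := by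
  apply (periodic_comp_coe v).intervalIntegrable₀ one_ne_zero
  rw [intervalIntegrable_iff_integrableOn_Ioc_of_le zero_le_one]
  exact measurePreserving_coe_Ioc.integrable_comp_of_integrable hv

/-- Measure preservation of the quotient map transports null sets from the circle to the interval.
The opposite direction is needed here, so the inverse map `AddCircle.equivIoc` is used. -/
lemma ae_of_ae_coe {P : UnitAddCircle → Prop}
    (h : ∀ᵐ t : ℝ ∂(volume.restrict (Set.Ioc (0 : ℝ) 1)), P (t : UnitAddCircle)) : ∀ᵐ x, P x := by
  have e := (AddCircle.measurePreserving_equivIoc (T := (1 : ℝ)) (a := 0))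
  have h1 : ∀ᵐ y : Set.Ioc (0 : ℝ) (0 + 1) ∂(Measure.comap Subtype.val volume),
      P ((y : ℝ) : UnitAddCircle) := by
    rw [zero_add]
    exact (ae_restrict_iff_subtype measurableSet_Ioc).1 h
  filter_upwards [e.quasiMeasurePreserving.ae h1] with x hx
  rwa [AddCircle.coe_equivIoc] at hx

lemma continuous_of_comp_coe {φ : UnitAddCircle → ℝ} (h : Continuous fun t : ℝ => φ t) :
    Continuous φ :=
  (QuotientAddGroup.isQuotientMap_mk _).continuous_iff.2 h

lemma IsTorusSmooth.continuous {φ : UnitAddCircle → ℝ} (h : IsTorusSmooth φ) : Continuous φ :=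
  continuous_of_comp_coe (ContDiff.continuous h)

lemma torusDeriv_coe (φ : UnitAddCircle → ℝ) (y : ℝ) :
    torusDeriv φ y = deriv (fun t : ℝ => φ t) y := by
  have := deriv_comp_const_add (fun t : ℝ => φ t) y 0
  rw [add_zero] at this
  rw [← this, torusDeriv]
  congr 1

lemma IsTorusSmooth.isPrimitive {φ : UnitAddCircle → ℝ} (h : IsTorusSmooth φ) :
    IsPrimitive (fun t : ℝ => φ t) (fun t : ℝ => torusDeriv φ t) := by
  refine .of_hasDerivAt (fun x => ?_) ?_
  · rw [torusDeriv_coe]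
    exact (ContDiff.differentiable h (by simp) x).hasDerivAt
  · simp_rw [torusDeriv_coe]
    exact ContDiff.continuous_deriv h (by simp)

lemma IsTorusSmooth.continuous_torusDeriv {φ : UnitAddCircle → ℝ} (h : IsTorusSmooth φ) :
    Continuous (torusDeriv φ) := by
  apply continuous_of_comp_coe
  simp_rw [torusDeriv_coe]
  exact ContDiff.continuous_deriv h (by simp)

lemma MeasureTheory.Integrable.mul_continuous {v φ : UnitAddCircle → ℝ} (hv : Integrable v)
    (hφ : Continuous φ) :
    Integrable (fun x => v x * φ x) := by
  obtain ⟨C, hC⟩ := isCompact_univ.exists_bound_of_continuousOn hφ.continuousOn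
  exact hv.mul_bdd (c := C) hφ.aestronglyMeasurable (Eventually.of_forall fun x => hC x trivial)

lemma hasWeakDeriv_of_isPrimitive {u g : UnitAddCircle → ℝ}
    (hu : IsPrimitive (fun t : ℝ => u t) (fun t : ℝ => g t)) : HasWeakDeriv u g := by
  intro φ hφ
  rw [torus_integral_eq, torus_integral_eq, ← neg_eq_iff_eq_neg]
  exact (hu.integral_mul_eq_neg hφ.isPrimitive (periodic_comp_coe u) (periodic_comp_coe φ)).symm

lemma HasWeakDeriv.sub {u g v k : UnitAddCircle → ℝ} (h1 : HasWeakDeriv u g)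
    (h2 : HasWeakDeriv v k) (hu : Integrable u) (hg : Integrable g) (hv : Integrable v)
    (hk : Integrable k) : HasWeakDeriv (fun x => u x - v x) (fun x => g x - k x) := by
  intro φ hφ
  have e1 : ∀ x, (u x - v x) * torusDeriv φ x = u x * torusDeriv φ x - v x * torusDeriv φ x :=
    fun x => sub_mul _ _ _
  have e2 : ∀ x, (g x - k x) * φ x = g x * φ x - k x * φ x := fun x => sub_mul _ _ _
  simp only [e1, e2]
  rw [integral_sub (hu.mul_continuous hφ.continuous_torusDeriv)
    (hv.mul_continuous hφ.continuous_torusDeriv), integral_sub (hg.mul_continuous hφ.continuous)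
    (hk.mul_continuous hφ.continuous), h1 φ hφ, h2 φ hφ]
  ring

lemma HasWeakDeriv.congr_left {u v g : UnitAddCircle → ℝ} (h : HasWeakDeriv u g)
    (huv : u =ᵐ[volume] v) : HasWeakDeriv v g := by
  intro φ hφ
  rw [← h φ hφ]
  exact integral_congr_ae (by filter_upwards [huv] with x hx; rw [hx])

/-- A function with support inside `(0,1)` extends periodically to a smooth function. -/
lemma contDiff_comp_fract {ψ : ℝ → ℝ} (hψ : ContDiff ℝ ∞ ψ) (hsupp : tsupport ψ ⊆ Set.Ioo 0 1) :
    ContDiff ℝ ∞ (fun t => ψ (Int.fract t)) := by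
  rw [contDiff_iff_contDiffAt]
  intro t
  have hz : ∀ z : ℝ, z ∉ Set.Ioo (0 : ℝ) 1 → ψ =ᶠ[𝓝 z] 0 := fun z hz =>
    notMem_tsupport_iff_eventuallyEq.1 fun h => hz (hsupp h)
  have key : (fun s => ψ (Int.fract s)) =ᶠ[𝓝 t] fun s => ψ (s - ⌊t⌋) := by
    -- Near a non-integer the floor is locally constant. Near an integer it jumps, but there both
    -- branches, `ψ` near `0` and `ψ` near `1`, vanish by the support condition.
    by_cases ht : Int.fract t = 0
    · have ht' : t = ⌊t⌋ := by
        have := Int.self_sub_floor t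
        linarith
      have e0 : ∀ᶠ s in 𝓝 t, ψ (s - ⌊t⌋) = 0 := by
        have : Tendsto (fun s : ℝ => s - ⌊t⌋) (𝓝 t) (𝓝 0) := by
          have := (by fun_prop : Continuous fun s : ℝ => s - ⌊t⌋).tendsto t
          rwa [show t - ⌊t⌋ = 0 by linarith] at this
        exact this.eventually (hz 0 (by simp))
      have e1 : ∀ᶠ s in 𝓝 t, ψ (s - ⌊t⌋ + 1) = 0 := by
        have : Tendsto (fun s : ℝ => s - ⌊t⌋ + 1) (𝓝 t) (𝓝 1) := by
          have := (by fun_prop : Continuous fun s : ℝ => s - ⌊t⌋ + 1).tendsto t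
          rwa [show t - ⌊t⌋ + 1 = 1 by linarith] at this
        exact this.eventually (hz 1 (by simp))
      have e2 : ∀ᶠ s in 𝓝 t, s ∈ Set.Ioo (t - 1) (t + 1) :=
        Ioo_mem_nhds (by linarith) (by linarith)
      filter_upwards [e0, e1, e2] with s h0 h1 h2
      rw [h0]
      rcases lt_or_ge s t with hs | hs
      · have : ⌊s⌋ = ⌊t⌋ - 1 := by
          rw [Int.floor_eq_iff]; push_cast
          exact ⟨by linarith [h2.1], by linarith⟩
        rw [← h1, Int.fract, this]; push_cast; ring_nf
      · have : ⌊s⌋ = ⌊t⌋ := by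
          rw [Int.floor_eq_iff]
          exact ⟨by linarith [h2.1], by linarith [h2.2]⟩
        rw [← h0, Int.fract, this]
    · have hpos : (⌊t⌋ : ℝ) < t := by
        have := (Int.fract_nonneg t).lt_of_ne (Ne.symm ht)
        rw [Int.fract] at this; linarith
      have e2 : ∀ᶠ s in 𝓝 t, s ∈ Set.Ioo (⌊t⌋ : ℝ) (⌊t⌋ + 1) :=
        Ioo_mem_nhds hpos (Int.lt_floor_add_one t)
      filter_upwards [e2] with s hs
      rw [Int.fract, Int.floor_eq_iff.2 ⟨hs.1.le, hs.2⟩]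
  refine ContDiffAt.congr_of_eventuallyEq ?_ key
  exact (hψ.comp (contDiff_id.sub contDiff_const)).contDiffAt

/-- Test functions supported in `(0,1)` extend periodically, so the fundamental lemma on the open
interval applies; the remaining point of the circle is null. -/
lemma ae_eq_zero_of_forall_integral_smooth {v : UnitAddCircle → ℝ} (hv : Integrable v)
    (h : ∀ φ, IsTorusSmooth φ → ∫ x, v x * φ x = 0) : v =ᵐ[volume] 0 := by
  have h1 : ∀ᵐ t : ℝ, t ∈ Set.Ioo (0 : ℝ) 1 → v t = 0 := by
    apply (isOpen_Ioo (a := (0 : ℝ)) (b := 1)).ae_eq_zero_of_integral_contDiff_smul_eq_zero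
    · have := (intervalIntegrable_iff_integrableOn_Ioc_of_le zero_le_one).1
        (hv.intervalIntegrable_coe 0 1)
      exact (this.mono_set Set.Ioo_subset_Ioc_self).locallyIntegrableOn
    · intro ψ hψ hc hs
      have hper : Function.Periodic (fun t => ψ (Int.fract t)) (1 : ℝ) := fun t => by
        simp [Int.fract_add_one]
      have hφ : IsTorusSmooth hper.lift := contDiff_comp_fract hψ hs
      have := h _ hφ
      rw [torus_integral_eq, intervalIntegral.integral_of_le zero_le_one,
        integral_Ioc_eq_integral_Ioo] at this
      rw [← setIntegral_eq_integral_of_forall_compl_eq_zero (s := Set.Ioo (0 : ℝ) 1)]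
      · refine Eq.trans ?_ this
        refine setIntegral_congr_fun measurableSet_Ioo fun t ht => ?_
        simp only [Function.Periodic.lift_coe, smul_eq_mul]
        rw [Int.fract_eq_self.2 ⟨ht.1.le, ht.2⟩, mul_comm]
      · intro t ht
        rw [image_eq_zero_of_notMem_tsupport fun h' => ht (hs h'), zero_smul]
  apply ae_of_ae_coe (P := fun x => v x = 0)
  rw [← restrict_Ioo_eq_restrict_Ioc]
  exact (ae_restrict_iff' measurableSet_Ioo).2 h1

lemma integral_eq_zero_of_hasWeakDeriv {u g : UnitAddCircle → ℝ} (h : HasWeakDeriv u g) :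
    ∫ x, g x = 0 := by
  have := h (fun _ => 1) contDiff_const
  simpa [torusDeriv] using this.symm

lemma HasWeakDeriv.ae_unique {u g k : UnitAddCircle → ℝ} (h1 : HasWeakDeriv u g)
    (h2 : HasWeakDeriv u k) (hg : Integrable g) (hk : Integrable k) : g =ᵐ[volume] k := by
  have := ae_eq_zero_of_forall_integral_smooth (hg.sub hk) fun φ hφ => by
    simp_rw [Pi.sub_apply, sub_mul]
    rw [integral_sub (hg.mul_continuous hφ.continuous) (hk.mul_continuous hφ.continuous)]
    linarith [h1 φ hφ, h2 φ hφ]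
  filter_upwards [this] with x hx
  simpa [sub_eq_zero] using hx

/-- A smooth periodic `φ` minus its mean `m` is the derivative of a smooth periodic function. Hence
`∫ v φ = m ∫ v`, so `v` minus its mean annihilates every test function. -/
lemma ae_const_of_hasWeakDeriv_zero {v : UnitAddCircle → ℝ} (hv : Integrable v)
    (h : HasWeakDeriv v 0) : ∃ c, v =ᵐ[volume] fun _ => c := by
  refine ⟨∫ x, v x, ?_⟩
  set c := ∫ x, v x with hc
  have := ae_eq_zero_of_forall_integral_smooth (hv.sub (integrable_const c)) fun φ hφ => by
    set m := ∫ x, φ x with hm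
    have hcont : Continuous fun t : ℝ => φ t - m := (ContDiff.continuous hφ).sub continuous_const
    have hd : ∀ x : ℝ, HasDerivAt (fun x : ℝ => ∫ t in (0 : ℝ)..x, (φ t - m)) (φ x - m) x := fun x =>
      intervalIntegral.integral_hasDerivAt_right (hcont.intervalIntegrable _ _)
        hcont.stronglyMeasurable.stronglyMeasurableAtFilter hcont.continuousAt
    have hper : Function.Periodic (fun x : ℝ => ∫ t in (0 : ℝ)..x, (φ t - m)) 1 := fun x => by
      have hp : Function.Periodic (fun t : ℝ => φ t - m) 1 := fun t => by
        simp
      have h0 : ∫ t in (0 : ℝ)..1, (φ t - m) = 0 := by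
        rw [intervalIntegral.integral_sub ((ContDiff.continuous hφ).intervalIntegrable _ _)
          intervalIntegrable_const, ← torus_integral_eq, ← hm]
        simp
      have h2 := hp.intervalIntegral_add_eq x 0
      rw [zero_add, h0] at h2
      simp only
      rw [← intervalIntegral.integral_add_adjacent_intervals (hcont.intervalIntegrable 0 x)
        (hcont.intervalIntegrable x (x + 1)), h2, add_zero]
    have hsm : IsTorusSmooth hper.lift := by
      change ContDiff ℝ ∞ (fun x : ℝ => ∫ t in (0 : ℝ)..x, (φ t - m))
      rw [contDiff_infty_iff_deriv]
      refine ⟨fun x => (hd x).differentiableAt, ?_⟩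
      rw [show deriv _ = _ from funext fun x => (hd x).deriv]
      exact ContDiff.sub hφ contDiff_const
    have key := h _ hsm
    have e : ∀ x, torusDeriv hper.lift x = φ x - m := fun x => by
      induction x using QuotientAddGroup.induction_on with
      | H y => rw [torusDeriv_coe]; exact (hd y).deriv
    simp only [e, Pi.zero_apply, zero_mul, integral_zero, neg_zero, mul_sub] at key
    rw [integral_sub (hv.mul_continuous hφ.continuous) (hv.mul_const m), integral_mul_const] at key
    simp_rw [Pi.sub_apply, sub_mul]
    rw [integral_sub (hv.mul_continuous hφ.continuous)
      ((integrable_const c).mul_continuous hφ.continuous), integral_const_mul]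
    exact key
  filter_upwards [this] with x hx
  simpa [sub_eq_zero] using hx

/-- A Sobolev function has an absolutely continuous representative. -/
lemma IsW11.exists_isPrimitive {u g : UnitAddCircle → ℝ} (h : IsW11 u g) :
    ∃ v : UnitAddCircle → ℝ, Continuous v ∧ v =ᵐ[volume] u ∧
      IsPrimitive (fun t : ℝ => v t) (fun t : ℝ => g t) := by
  have hint := h.integrable_deriv.intervalIntegrable_coe
  have h0 : ∫ t in (0 : ℝ)..1, g t = 0 := by
    rw [← torus_integral_eq]; exact integral_eq_zero_of_hasWeakDeriv h.hasWeakDeriv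
  -- The primitive of `g` is periodic because `g` has mean zero; `u` minus this primitive then has
  -- zero weak derivative, hence is constant.
  have hper : Function.Periodic (fun x : ℝ => 0 + ∫ t in (0 : ℝ)..x, g t) 1 := fun x => by
    have h2 := (periodic_comp_coe g).intervalIntegral_add_eq x 0
    rw [zero_add, h0] at h2
    simp only
    rw [← intervalIntegral.integral_add_adjacent_intervals (hint 0 x) (hint x (x + 1)), h2,
      add_zero]
  have hp : IsPrimitive (fun t : ℝ => hper.lift t) (fun t : ℝ => g t) :=
    .of_integral hint 0
  have hcont : Continuous hper.lift := continuous_of_comp_coe hp.continuous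
  have hG : Integrable hper.lift := hcont.integrable_of_hasCompactSupport
    (HasCompactSupport.of_compactSpace _)
  have hz : HasWeakDeriv (fun x => u x - hper.lift x) 0 := by
    have := h.hasWeakDeriv.sub (hasWeakDeriv_of_isPrimitive hp) h.integrable h.integrable_deriv hG
      h.integrable_deriv
    simp only [sub_self] at this
    exact this
  obtain ⟨c, hc⟩ := ae_const_of_hasWeakDeriv_zero (h.integrable.sub hG) hz
  refine ⟨fun x => hper.lift x + c, hcont.add continuous_const, ?_, hp.intervalIntegrable,
    fun a b => ?_⟩
  · filter_upwards [hc] with x hx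
    rw [Pi.sub_apply] at hx
    linarith
  · rw [hp.integral_eq]; ring

/-! ### Convex functions of linear growth and their regularized derivatives -/

section Convex

variable {W : ℝ → ℝ}

/-- Secant slopes issuing from `x` increase with the other endpoint, and they tend to the asymptotic
slope `a`. -/
lemma ConvexOn.sub_le_mul_sub_of_tendsto (hW : ConvexOn ℝ Set.univ W) {a : ℝ}
    (ha : Tendsto (fun t => W t / t) atTop (𝓝 a)) {x y : ℝ} (hxy : x ≤ y) :
    W y - W x ≤ a * (y - x) := by
  rcases hxy.eq_or_lt with rfl | hxy
  · simp
  have hlim : Tendsto (fun t => (W t - W x) / (t - x)) atTop (𝓝 a) := by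
    have h1 : Tendsto (fun t : ℝ => (W t / t - W x / t) / (1 - x / t)) atTop
        (𝓝 ((a - 0) / (1 - 0))) :=
      (ha.sub (tendsto_const_nhds.div_atTop tendsto_id)).div
        (tendsto_const_nhds.sub (tendsto_const_nhds.div_atTop tendsto_id)) (by simp)
    rw [sub_zero, sub_zero, div_one] at h1
    refine h1.congr' ?_
    filter_upwards [eventually_gt_atTop (max 0 x)] with t ht
    have h0 : 0 < t := (le_max_left _ _).trans_lt ht
    have h2 : 0 < t - x := sub_pos.2 ((le_max_right _ _).trans_lt ht)
    field_simp
  have hle : (W y - W x) / (y - x) ≤ a := by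
    refine ge_of_tendsto hlim ?_
    filter_upwards [eventually_gt_atTop y] with t ht
    exact hW.secant_mono (Set.mem_univ x) (Set.mem_univ y) (Set.mem_univ t) hxy.ne'
      (hxy.trans ht).ne' ht.le
  rwa [div_le_iff₀ (sub_pos.2 hxy)] at hle

/-- The asymptotic slopes of `W` and of its reflection bound the increments from both sides. -/
lemma ConvexOn.exists_lipschitz_of_hasLinearGrowth (hW : ConvexOn ℝ Set.univ W)
    (hg : HasLinearGrowth W) : ∃ L, 0 ≤ L ∧ ∀ x y, |W x - W y| ≤ L * |x - y| := by
  obtain ⟨a, b, ha, hb, h1, h2⟩ := hg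
  have hW' : ConvexOn ℝ Set.univ (fun t => W (-t)) := by
    have := hW.comp_linearMap (-LinearMap.id)
    simpa [Function.comp_def] using this
  have key : ∀ x y, x ≤ y → |W x - W y| ≤ max a b * |x - y| := fun x y hxy => by
    have e1 := hW.sub_le_mul_sub_of_tendsto h1 hxy
    have e2 := hW'.sub_le_mul_sub_of_tendsto h2 (neg_le_neg hxy)
    simp only [neg_neg] at e2
    have hd : 0 ≤ y - x := sub_nonneg.2 hxy
    have e3 := mul_le_mul_of_nonneg_right (le_max_left a b) hd
    have e4 := mul_le_mul_of_nonneg_right (le_max_right a b) hd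
    rw [abs_sub_comm x y, abs_of_nonneg hd, abs_le]
    constructor <;> linarith
  refine ⟨max a b, ha.le.trans (le_max_left _ _), fun x y => ?_⟩
  rcases le_total x y with h | h
  · exact key x y h
  · rw [abs_sub_comm, abs_sub_comm x y]; exact key y x h

/-- Both `p + s` and `q` are convex combinations of `p` and `q + s`, with the weights exchanged; the
two convexity inequalities are added. -/
lemma ConvexOn.increment_mono (hW : ConvexOn ℝ Set.univ W) {p q s : ℝ} (hpq : p ≤ q)
    (hs : 0 ≤ s) : W (p + s) - W p ≤ W (q + s) - W q := by
  rcases hpq.eq_or_lt with rfl | hpq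
  · rfl
  have hd : 0 < s + (q - p) := by linarith
  have hne := hd.ne'
  have hl : s / (s + (q - p)) + (q - p) / (s + (q - p)) = 1 := by field_simp
  have h1 := hW.2 (Set.mem_univ p) (Set.mem_univ (q + s))
    (div_nonneg (sub_nonneg.2 hpq.le) hd.le) (div_nonneg hs hd.le) (by linarith)
  have h2 := hW.2 (Set.mem_univ p) (Set.mem_univ (q + s)) (div_nonneg hs hd.le)
    (div_nonneg (sub_nonneg.2 hpq.le) hd.le) hl
  simp only [smul_eq_mul] at h1 h2
  rw [show (q - p) / (s + (q - p)) * p + s / (s + (q - p)) * (q + s) = p + s by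
    field_simp; ring] at h1
  rw [show s / (s + (q - p)) * p + (q - p) / (s + (q - p)) * (q + s) = q by
    field_simp; ring] at h2
  have h3 : ∀ A B : ℝ, (q - p) / (s + (q - p)) * A + s / (s + (q - p)) * B +
      (s / (s + (q - p)) * A + (q - p) / (s + (q - p)) * B) = A + B := fun A B => by
    field_simp; ring
  linarith [h3 (W p) (W (q + s))]

/-- The symmetric difference quotient of `W` with step `ε`. -/
noncomputable def centralSlope (W : ℝ → ℝ) (ε p : ℝ) : ℝ := (W (p + ε) - W (p - ε)) / (2 * ε)

lemma centralSlope_mono (hW : ConvexOn ℝ Set.univ W) {ε : ℝ} (hε : 0 < ε) :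
    Monotone (centralSlope W ε) := fun p q hpq => by
  have := hW.increment_mono (sub_le_sub_right hpq ε) (by positivity : 0 ≤ 2 * ε)
  rw [show p - ε + 2 * ε = p + ε by ring, show q - ε + 2 * ε = q + ε by ring] at this
  exact div_le_div_of_nonneg_right this (by positivity)

lemma abs_centralSlope_le {L : ℝ} (hL : ∀ x y, |W x - W y| ≤ L * |x - y|)
    {ε : ℝ} (hε : 0 < ε) (p : ℝ) : |centralSlope W ε p| ≤ L := by
  rw [centralSlope, abs_div, abs_of_pos (by positivity : 0 < 2 * ε), div_le_iff₀ (by positivity)]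
  have := hL (p + ε) (p - ε)
  rwa [show p + ε - (p - ε) = 2 * ε by ring, abs_of_pos (by positivity : 0 < 2 * ε)] at this

lemma centralSlope_sub_le {L : ℝ} (hL : ∀ x y, |W x - W y| ≤ L * |x - y|)
    {ε : ℝ} (hε : 0 < ε) (p q : ℝ) :
    centralSlope W ε q - centralSlope W ε p ≤ L / ε * |q - p| := by
  have h1 := (abs_le.1 (hL (q + ε) (p + ε))).2
  have h2 := (abs_le.1 (hL (q - ε) (p - ε))).1
  rw [show q + ε - (p + ε) = q - p by ring] at h1
  rw [show q - ε - (p - ε) = q - p by ring] at h2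
  rw [centralSlope, centralSlope, ← sub_div, div_le_iff₀ (by positivity)]
  have : L / ε * |q - p| * (2 * ε) = 2 * (L * |q - p|) := by field_simp
  linarith

/-- The symmetric difference quotient is an approximate subgradient. -/
lemma le_of_centralSlope {L : ℝ} (hL : ∀ x y, |W x - W y| ≤ L * |x - y|)
    (hW : ConvexOn ℝ Set.univ W) {ε : ℝ} (hε : 0 < ε) (p q : ℝ) :
    W p + centralSlope W ε p * (q - p) - 2 * L * ε ≤ W q := by
  have hb := abs_le.1 (abs_centralSlope_le hL hε p)
  set b := centralSlope W ε p with hbdef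
  have hbe : 2 * ε * b = W (p + ε) - W (p - ε) := by rw [hbdef, centralSlope]; field_simp
  have h1 := abs_le.1 (hL (p + ε) p)
  have h2 := abs_le.1 (hL (p - ε) p)
  rw [show p + ε - p = ε by ring, abs_of_pos hε] at h1
  rw [show p - ε - p = -ε by ring, abs_neg, abs_of_pos hε] at h2
  -- Outside `(p - ε, p + ε)` adjacent secant slopes are compared, and moving the base point from `p
  -- ± ε` to `p` costs `Lε` in `W` and `Lε` in the linear term. Inside, the increment of `W` and the
  -- linear term are each at most `Lε`.
  rcases le_or_gt (p + ε) q with hq | hq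
  · rcases hq.eq_or_lt with rfl | hq
    · nlinarith
    have := hW.slope_mono_adjacent (Set.mem_univ (p - ε)) (Set.mem_univ q)
      (by linarith : p - ε < p + ε) hq
    rw [show p + ε - (p - ε) = 2 * ε by ring, ← hbe, mul_div_cancel_left₀ _ (by positivity),
      le_div_iff₀ (by linarith)] at this
    nlinarith
  rcases le_or_gt q (p - ε) with hq' | hq'
  · rcases hq'.eq_or_lt with rfl | hq'
    · nlinarith
    have := hW.slope_mono_adjacent (Set.mem_univ q) (Set.mem_univ (p + ε)) hq'
      (by linarith : p - ε < p + ε)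
    rw [show p + ε - (p - ε) = 2 * ε by ring, ← hbe, mul_div_cancel_left₀ _ (by positivity),
      div_le_iff₀ (by linarith)] at this
    nlinarith
  · have hqp : |q - p| ≤ ε := abs_le.2 ⟨by linarith, by linarith⟩
    have h3 := (abs_le.1 (hL q p)).1
    have h0 : 0 ≤ L := by linarith
    have h4 : b * (q - p) ≤ L * |q - p| := by
      refine (le_abs_self _).trans ?_
      rw [abs_mul]
      exact mul_le_mul_of_nonneg_right (abs_le.2 hb) (abs_nonneg _)
    have h5 := mul_le_mul_of_nonneg_left hqp h0
    linarith

lemma continuous_of_lipschitz_bound {L : ℝ} (hL : ∀ x y, |W x - W y| ≤ L * |x - y|) : Continuous W := by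
  have h0 : 0 ≤ L := by simpa using (abs_nonneg _).trans (hL 1 0)
  exact (LipschitzWith.of_dist_le_mul (K := ⟨L, h0⟩) fun x y => by
    rw [Real.dist_eq, Real.dist_eq]; exact hL x y).continuous

/-- The regularized derivative of `W` has a bi-Lipschitz inverse. -/
lemma exists_inverse_regularization {L : ℝ} (hL : ∀ x y, |W x - W y| ≤ L * |x - y|)
    (hW : ConvexOn ℝ Set.univ W) {ε : ℝ} (hε : 0 < ε) :
    ∃ (γ : ℝ → ℝ) (c : ℝ), 0 < c ∧
      (∀ s t, s ≤ t → c * (t - s) ≤ γ t - γ s ∧ γ t - γ s ≤ 1 / ε * (t - s)) ∧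
      ∀ s, centralSlope W ε (γ s) + ε * γ s = s := by
  have h0 : 0 ≤ L := by simpa using (abs_nonneg _).trans (hL 1 0)
  set β : ℝ → ℝ := fun p => centralSlope W ε p + ε * p with hβ
  have hlow : ∀ p q, p ≤ q → ε * (q - p) ≤ β q - β p := fun p q hpq => by
    have := centralSlope_mono hW hε hpq
    simp only [hβ]; linarith
  have hup : ∀ p q, p ≤ q → β q - β p ≤ (L / ε + ε) * (q - p) := fun p q hpq => by
    have := centralSlope_sub_le hL hε p q
    rw [abs_of_nonneg (sub_nonneg.2 hpq)] at this
    simp only [hβ]; linarith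
  have hsm : StrictMono β := fun p q hpq => by
    nlinarith [hlow p q hpq.le, mul_pos hε (sub_pos.2 hpq)]
  have hcont : Continuous β := by
    have := continuous_of_lipschitz_bound hL
    simp only [hβ, centralSlope]
    fun_prop
  have hsurj : Function.Surjective β := by
    refine hcont.surjective ?_ ?_
    · exact tendsto_atTop_add_left_of_le _ (-L) (fun p => (abs_le.1 (abs_centralSlope_le hL hε p)).1)
        (tendsto_id.const_mul_atTop hε)
    · exact tendsto_atBot_add_left_of_ge _ L (fun p => (abs_le.1 (abs_centralSlope_le hL hε p)).2)
        (tendsto_id.const_mul_atBot hε)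
  choose γ hγ using hsurj
  -- The increments of `β` lie between `ε` and `L / ε + ε` times those of its argument; inverting
  -- exchanges the roles of the two bounds.
  refine ⟨γ, (L / ε + ε)⁻¹, by positivity, fun s t hst => ?_, hγ⟩
  have hm : γ s ≤ γ t := by
    rw [← hsm.le_iff_le, hγ, hγ]; exact hst
  have e1 := hlow _ _ hm
  have e2 := hup _ _ hm
  rw [hγ, hγ] at e1 e2
  constructor
  · rw [inv_mul_le_iff₀ (by positivity)]; exact e2
  · rw [one_div, le_inv_mul_iff₀ hε]; exact e1

end Convex

/-! ### Periodic solutions of the regularized system -/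

lemma Function.Periodic.exists_forall_le_of_continuous {v : ℝ → ℝ} (hp : Function.Periodic v 1)
    (hv : Continuous v) : ∃ x₀, ∀ x, v x ≤ v x₀ := by
  obtain ⟨x₀, -, hx₀⟩ := isCompact_Icc.exists_isMaxOn (Set.nonempty_Icc.2 zero_le_one)
    (hv.continuousOn (s := Set.Icc (0 : ℝ) 1))
  refine ⟨x₀, fun x => ?_⟩
  obtain ⟨y, hy, hxy⟩ := hp.exists_mem_Ico₀ one_pos x
  rw [hxy]
  exact hx₀ (Set.Ico_subset_Icc_self hy)

/-- The scalar linear equation `w' = μ w + G` has a periodic solution. -/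
lemma exists_periodic_solution {μ : ℝ} (hμ : μ ≠ 0) {G : ℝ → ℝ} (hG : Continuous G)
    (hp : Function.Periodic G 1) :
    ∃ w : ℝ → ℝ, Function.Periodic w 1 ∧ ∀ x, HasDerivAt w (μ * w x + G x) x := by
  have hcont : Continuous fun y => Real.exp (-(μ * y)) * G y := by fun_prop
  have hI : ∀ x, HasDerivAt (fun x => ∫ y in (0 : ℝ)..x, Real.exp (-(μ * y)) * G y)
      (Real.exp (-(μ * x)) * G x) x := fun x =>
    intervalIntegral.integral_hasDerivAt_right (hcont.intervalIntegrable _ _)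
      hcont.stronglyMeasurable.stronglyMeasurableAtFilter hcont.continuousAt
  set I := fun x => ∫ y in (0 : ℝ)..x, Real.exp (-(μ * y)) * G y with hIdef
  have hE : 1 - Real.exp μ ≠ 0 := sub_ne_zero.2 fun h => hμ (Real.exp_eq_one_iff μ |>.1 h.symm)
  -- This initial value solves `w 1 = w 0`, since `I 0 = 0`. Periodicity follows because `w (x + 1)
  -- - w x` solves the homogeneous equation and vanishes at `0`.
  set C := Real.exp μ * I 1 / (1 - Real.exp μ) with hC
  set w := fun x => Real.exp (μ * x) * (C + I x) with hw
  have hexp : ∀ (a : ℝ) x, HasDerivAt (fun x => Real.exp (a * x)) (Real.exp (a * x) * a) x :=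
    fun a x => by simpa using ((hasDerivAt_id x).const_mul a).exp
  have hwd : ∀ x, HasDerivAt w (μ * w x + G x) x := fun x => by
    have := (hexp μ x).mul ((hI x).const_add C)
    convert! this using 1
    have he : Real.exp (μ * x) * Real.exp (-(μ * x)) = 1 := by
      rw [← Real.exp_add, add_neg_cancel, Real.exp_zero]
    simp only [hw]
    rw [← mul_assoc (Real.exp (μ * x)) (Real.exp (-(μ * x))), he]
    ring
  refine ⟨w, ?_, hwd⟩
  have hv : ∀ x, HasDerivAt (fun x => (w (x + 1) - w x) * Real.exp (-μ * x)) 0 x := fun x => by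
    have h1 : HasDerivAt (fun x => w (x + 1)) (μ * w (x + 1) + G x) x := by
      have := (hwd (x + 1)).comp_add_const x 1
      rwa [hp x] at this
    have := (h1.sub (hwd x)).mul (hexp (-μ) x)
    convert! this using 1
    simp only [Pi.sub_apply]
    ring
  intro x
  have h0 := is_const_of_deriv_eq_zero (fun x => (hv x).differentiableAt)
    (fun x => (hv x).deriv) x 0
  have h1 : w 1 = w 0 := by
    have hI0 : I 0 = 0 := by simp [hIdef]
    simp only [hw, hI0, mul_one, mul_zero, Real.exp_zero, one_mul, add_zero]
    rw [hC]; field_simp; ring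
  simp only [zero_add, h1, sub_self, zero_mul] at h0
  exact sub_eq_zero.1 ((mul_eq_zero.1 h0).resolve_right (Real.exp_pos _).ne')

/-- Maximum principle for periodic solutions of `w' = μ w + G`. -/
lemma abs_mul_abs_le_of_periodic_solution {μ K : ℝ} {G w : ℝ → ℝ} (hp : Function.Periodic w 1)
    (hw : ∀ x, HasDerivAt w (μ * w x + G x) x) (hK : ∀ x, |G x| ≤ K) (x : ℝ) :
    |μ| * |w x| ≤ K := by
  have hc : Continuous w := continuous_iff_continuousAt.2 fun x => (hw x).continuousAt
  -- At a maximum of `w²` one has `w w' = 0`, so either `w` vanishes there or `μ w = -G`.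
  obtain ⟨x₀, h₀⟩ := Function.Periodic.exists_forall_le_of_continuous
    (v := fun x => w x ^ 2) (fun x => by simp only [hp x]) (hc.pow 2)
  have hd := (hw x₀).pow 2
  have hz := IsLocalMax.hasDerivAt_eq_zero (f := w ^ 2) (Eventually.of_forall h₀) hd
  have hx : |w x| ≤ |w x₀| := sq_le_sq.1 (h₀ x)
  refine (mul_le_mul_of_nonneg_left hx (abs_nonneg μ)).trans ?_
  rw [← abs_mul]
  simp only [Nat.cast_ofNat, Nat.add_one_sub_one, pow_one, mul_eq_zero, OfNat.ofNat_ne_zero,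
    false_or] at hz
  rcases hz with hz | hz
  · rw [hz, mul_zero, abs_zero]; exact (abs_nonneg _).trans (hK 0)
  · rw [eq_neg_of_add_eq_zero_left hz, abs_neg]; exact hK x₀

/-- The linear system `u' = lam ζ + G`, `h ζ' = u - F` has a periodic solution. -/
lemma exists_periodic_linear_system {h lam : ℝ} (hh : 0 < h) (hlam : 0 < lam) {F G : ℝ → ℝ}
    (hF : Continuous F) (hFp : Function.Periodic F 1) (hG : Continuous G)
    (hGp : Function.Periodic G 1) :
    ∃ u ζ : ℝ → ℝ, Function.Periodic u 1 ∧ Function.Periodic ζ 1 ∧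
      (∀ x, HasDerivAt u (lam * ζ x + G x) x) ∧ ∀ x, HasDerivAt ζ ((u x - F x) / h) x := by
  set κ := √(lam / h) with hκ
  have hκpos : 0 < κ := Real.sqrt_pos.2 (div_pos hlam hh)
  have hκ2 : h * κ ^ 2 = lam := by
    rw [hκ, Real.sq_sqrt (div_pos hlam hh).le]; field_simp
  -- Since `h κ² = lam`, the combinations `a = u + hκζ` and `b = u - hκζ` diagonalize the system
  -- into scalar equations with rates `κ` and `-κ`.
  obtain ⟨a, hap, ha⟩ := exists_periodic_solution hκpos.ne' (G := fun x => G x - κ * F x)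
    (by fun_prop) (fun x => by simp only [hGp x, hFp x])
  obtain ⟨b, hbp, hb⟩ := exists_periodic_solution (neg_ne_zero.2 hκpos.ne')
    (G := fun x => G x + κ * F x) (by fun_prop) (fun x => by simp only [hGp x, hFp x])
  refine ⟨fun x => (a x + b x) / 2, fun x => (a x - b x) / (2 * h * κ),
    fun x => by simp only [hap x, hbp x], fun x => by simp only [hap x, hbp x],
    fun x => ?_, fun x => ?_⟩
  · convert! ((ha x).add (hb x)).div_const 2 using 1
    rw [← hκ2]; field_simp; ring
  · convert! ((ha x).sub (hb x)).div_const (2 * h * κ) using 1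
    field_simp; ring

/-- The diagonal variables `U ± hκZ` are each bounded by `K / κ`, and they differ by `2hκZ`. The
constant is sharp enough for the contraction argument that follows. -/
lemma abs_le_of_periodic_linear_system {h lam K : ℝ} (hh : 0 < h) (hlam : 0 < lam) {U Z D : ℝ → ℝ}
    (hUp : Function.Periodic U 1) (hZp : Function.Periodic Z 1)
    (hU : ∀ x, HasDerivAt U (lam * Z x + D x) x) (hZ : ∀ x, HasDerivAt Z (U x / h) x)
    (hK : ∀ x, |D x| ≤ K) (x : ℝ) : lam * |Z x| ≤ K := by
  set κ := √(lam / h) with hκ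
  have hκpos : 0 < κ := Real.sqrt_pos.2 (div_pos hlam hh)
  have hκ2 : h * κ ^ 2 = lam := by
    rw [hκ, Real.sq_sqrt (div_pos hlam hh).le]; field_simp
  have h1 := abs_mul_abs_le_of_periodic_solution (μ := κ) (G := D)
    (w := fun x => U x + h * κ * Z x) (fun x => by simp only [hUp x, hZp x])
    (fun x => by
      convert! (hU x).add ((hZ x).const_mul (h * κ)) using 1
      rw [← hκ2]; field_simp; ring) hK x
  have h2 := abs_mul_abs_le_of_periodic_solution (μ := -κ) (G := D)
    (w := fun x => U x - h * κ * Z x) (fun x => by simp only [hUp x, hZp x])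
    (fun x => by
      convert! (hU x).sub ((hZ x).const_mul (h * κ)) using 1
      rw [← hκ2]; field_simp; ring) hK x
  rw [abs_neg, abs_of_pos hκpos] at h2
  rw [abs_of_pos hκpos] at h1
  have h3 : 2 * (h * κ * |Z x|) ≤ |U x + h * κ * Z x| + |U x - h * κ * Z x| := by
    have := abs_sub (U x + h * κ * Z x) (U x - h * κ * Z x)
    rw [show U x + h * κ * Z x - (U x - h * κ * Z x) = 2 * (h * κ) * Z x by ring, abs_mul,
      abs_of_pos (by positivity : 0 < 2 * (h * κ))] at this
    linarith
  have h4 := mul_le_mul_of_nonneg_left h3 hκpos.le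
  rw [← hκ2]
  linarith

/-- The system `u' = γ(ξ)`, `h ξ' = u - F` with `γ` bi-Lipschitz has a periodic solution. -/
lemma exists_periodic_system {h lam c : ℝ} (hh : 0 < h) (hlam : 0 < lam) (hc : 0 < c)
    {F γ : ℝ → ℝ} (hF : Continuous F) (hFp : Function.Periodic F 1)
    (hγ : ∀ s t, s ≤ t → c * (t - s) ≤ γ t - γ s ∧ γ t - γ s ≤ lam * (t - s)) :
    ∃ u ξ : ℝ → ℝ, Function.Periodic u 1 ∧ Function.Periodic ξ 1 ∧
      (∀ x, HasDerivAt u (γ (ξ x)) x) ∧ ∀ x, HasDerivAt ξ ((u x - F x) / h) x := by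
  have hcl : c ≤ lam := by linarith [hγ 0 1 zero_le_one]
  -- The nonlinear remainder `γ - lam · id` has Lipschitz constant `lam - c`. Freezing it at `ξ` and
  -- solving the linear system, whose flux is bounded by the source over `lam`, gives a contraction
  -- of ratio `1 - c / lam`.
  have hdiff : ∀ s t, |(γ t - lam * t) - (γ s - lam * s)| ≤ (lam - c) * |t - s| := by
    have aux : ∀ s t, s ≤ t → |(γ t - lam * t) - (γ s - lam * s)| ≤ (lam - c) * |t - s| :=
      fun s t hst => by
        rw [abs_of_nonneg (sub_nonneg.2 hst), abs_le]
        have := hγ s t hst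
        constructor <;> nlinarith [mul_nonneg hc.le (sub_nonneg.2 hst)]
    intro s t
    rcases le_total s t with hst | hst
    · exact aux s t hst
    · rw [abs_sub_comm, abs_sub_comm t s]; exact aux t s hst
  have hγc : Continuous γ := by
    have h1 : LipschitzWith ⟨lam - c, sub_nonneg.2 hcl⟩ (fun t => γ t - lam * t) :=
      .of_dist_le_mul fun s t => by
        rw [Real.dist_eq, Real.dist_eq]; exact hdiff t s
    have := h1.continuous.add (continuous_const.mul continuous_id : Continuous fun t => lam * t)
    convert! this using 1
    funext t
    simp
  have hex : ∀ ξ : C(UnitAddCircle, ℝ), ∃ u ζ : ℝ → ℝ, Function.Periodic u 1 ∧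
      Function.Periodic ζ 1 ∧ (∀ x, HasDerivAt u (lam * ζ x + (γ (ξ x) - lam * ξ x)) x) ∧
      ∀ x, HasDerivAt ζ ((u x - F x) / h) x := fun ξ => by
    have hξc : Continuous fun t : ℝ => ξ t := ξ.continuous.comp (AddCircle.continuous_mk' 1)
    exact exists_periodic_linear_system hh hlam hF hFp (by fun_prop)
      (periodic_comp_coe fun y => γ (ξ y) - lam * ξ y)
  choose u ζ hu hζ hdu hdζ using hex
  have hζc : ∀ ξ, Continuous (ζ ξ) := fun ξ =>
    continuous_iff_continuousAt.2 fun x => (hdζ ξ x).continuousAt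
  set Θ : C(UnitAddCircle, ℝ) → C(UnitAddCircle, ℝ) := fun ξ =>
    ⟨(hζ ξ).lift, continuous_of_comp_coe (hζc ξ)⟩ with hΘ
  have hcl' : 0 ≤ 1 - c / lam := sub_nonneg.2 ((div_le_one hlam).2 hcl)
  have hcontr : ContractingWith (1 - c / lam).toNNReal Θ := by
    refine ⟨?_, .of_dist_le_mul fun ξ η => ?_⟩
    · rw [Real.toNNReal_lt_one]
      exact sub_lt_self _ (div_pos hc hlam)
    · rw [Real.coe_toNNReal _ hcl']
      refine (ContinuousMap.dist_le (by positivity)).2 fun x => ?_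
      induction x using QuotientAddGroup.induction_on with
      | H y =>
        rw [Real.dist_eq]
        change |ζ ξ y - ζ η y| ≤ (1 - c / lam) * dist ξ η
        have := abs_le_of_periodic_linear_system hh hlam (K := (lam - c) * dist ξ η)
          (U := fun x => u ξ x - u η x) (Z := fun x => ζ ξ x - ζ η x)
          (D := fun x => (γ (ξ x) - lam * ξ x) - (γ (η x) - lam * η x))
          (fun x => by simp only [hu ξ x, hu η x]) (fun x => by simp only [hζ ξ x, hζ η x])
          (fun x => by convert! (hdu ξ x).sub (hdu η x) using 1; ring)
          (fun x => by convert! (hdζ ξ x).sub (hdζ η x) using 1; ring)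
          (fun x => (hdiff _ _).trans (mul_le_mul_of_nonneg_left
            (by rw [← Real.dist_eq]; exact ContinuousMap.dist_apply_le_dist _)
            (sub_nonneg.2 hcl))) y
        rw [← mul_le_mul_iff_right₀ hlam]
        refine this.trans_eq ?_
        field_simp
  set ξ := hcontr.fixedPoint Θ
  have hfix : ∀ y : ℝ, ζ ξ y = ξ y := fun y =>
    congrArg (fun f : C(UnitAddCircle, ℝ) => f y) hcontr.fixedPoint_isFixedPt
  refine ⟨u ξ, ζ ξ, hu ξ, hζ ξ, fun x => ?_, hdζ ξ⟩
  convert! hdu ξ x using 1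
  rw [hfix]; ring

/-! ### Uniform estimates for the regularized problem -/

/-- `L¹` accretivity of `-d''` against a function `P` with the sign of `d`. -/
lemma integral_abs_le_of_sign {h : ℝ} (hh : 0 < h) {d k q P : ℝ → ℝ}
    (hdp : Function.Periodic d 1) (hkp : Function.Periodic k 1)
    (hd : ∀ x, HasDerivAt d (k x / h) x) (hk : IsPrimitive k q)
    (hP : IntervalIntegrable P volume 0 1) (hPd : ∀ x, 0 ≤ P x * d x)
    (hP0 : ∀ x, d x = 0 → P x = 0) :
    ∫ x in (0 : ℝ)..1, |P x| ≤ ∫ x in (0 : ℝ)..1, |P x - q x| := by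
  have hdc : Continuous d := continuous_iff_continuousAt.2 fun x => (hd x).continuousAt
  have hq := hk.intervalIntegrable 0 1
  have hpi : 0 < Real.pi / 2 := by positivity
  have hat : ∀ y, |Real.arctan y| ≤ Real.pi / 2 := fun y =>
    abs_le.2 ⟨(Real.neg_pi_div_two_lt_arctan y).le, (Real.arctan_lt_pi_div_two y).le⟩
  -- The function `arctan (n d)` is a smooth increasing substitute for `π/2` times the sign of `d`.
  -- Integrated against `q = k'`, with `d' = k / h`, it yields minus the integral of a nonnegative
  -- multiple of `k²`.
  have step : ∀ n : ℕ, ∫ x in (0 : ℝ)..1, Real.arctan (n * d x) * P x ≤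
      Real.pi / 2 * ∫ x in (0 : ℝ)..1, |P x - q x| := fun n => by
    have hψc : Continuous fun x => Real.arctan (n * d x) := by fun_prop
    have hψ : IsPrimitive (fun x => Real.arctan (n * d x))
        (fun x => 1 / (1 + (n * d x) ^ 2) * (n * (k x / h))) := by
      refine .of_hasDerivAt (fun x => ((hd x).const_mul (n : ℝ)).arctan) ?_
      have := hk.continuous
      refine .mul (.div continuous_const (by fun_prop) fun x => by positivity) (by fun_prop)
    have hint := hk.integral_mul_eq_neg hψ hkp (fun x => by simp only [hdp x])
    have hneg : ∫ x in (0 : ℝ)..1, q x * Real.arctan (n * d x) ≤ 0 := by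
      rw [hint, neg_nonpos]
      refine intervalIntegral.integral_nonneg zero_le_one fun x _ => ?_
      rw [show k x * (1 / (1 + (n * d x) ^ 2) * (n * (k x / h))) =
        n * (k x) ^ 2 / ((1 + (n * d x) ^ 2) * h) by field_simp]
      positivity
    have h1 : ∫ x in (0 : ℝ)..1, Real.arctan (n * d x) * P x =
        (∫ x in (0 : ℝ)..1, q x * Real.arctan (n * d x)) +
          ∫ x in (0 : ℝ)..1, Real.arctan (n * d x) * (P x - q x) := by
      rw [← intervalIntegral.integral_add (hq.mul_continuousOn hψc.continuousOn)
        ((hP.sub hq).continuousOn_mul hψc.continuousOn)]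
      congr 1; funext x; ring
    have h2 : ∫ x in (0 : ℝ)..1, Real.arctan (n * d x) * (P x - q x) ≤
        ∫ x in (0 : ℝ)..1, Real.pi / 2 * |P x - q x| := by
      refine intervalIntegral.integral_mono_on zero_le_one
        ((hP.sub hq).continuousOn_mul hψc.continuousOn) ((hP.sub hq).abs.const_mul _) fun x _ => ?_
      refine (le_abs_self _).trans ?_
      rw [abs_mul]
      exact mul_le_mul_of_nonneg_right (hat _) (abs_nonneg _)
    rw [intervalIntegral.integral_const_mul] at h2
    linarith
  have hlim : Tendsto (fun n : ℕ => ∫ x in (0 : ℝ)..1, Real.arctan (n * d x) * P x) atTop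
      (𝓝 (∫ x in (0 : ℝ)..1, Real.pi / 2 * |P x|)) := by
    refine intervalIntegral.tendsto_integral_filter_of_dominated_convergence
      (fun x => Real.pi / 2 * |P x|) (Eventually.of_forall fun n => ?_)
      (Eventually.of_forall fun n => Eventually.of_forall fun x _ => ?_) (hP.abs.const_mul _)
      (Eventually.of_forall fun x _ => ?_)
    · exact (by fun_prop : Continuous fun x => Real.arctan (n * d x)).aestronglyMeasurable.mul
        hP.aestronglyMeasurable_restrict_uIoc
    · rw [Real.norm_eq_abs, abs_mul]
      exact mul_le_mul_of_nonneg_right (hat _) (abs_nonneg _)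
    · rcases lt_trichotomy (d x) 0 with hx | hx | hx
      · have hPx : P x ≤ 0 := nonpos_of_mul_nonneg_left (hPd x) hx
        have h1 : Tendsto (fun n : ℕ => (n : ℝ) * d x) atTop atBot :=
          tendsto_natCast_atTop_atTop.atTop_mul_const_of_neg hx
        have := ((Real.tendsto_arctan_atBot.mono_right nhdsWithin_le_nhds).comp h1).mul_const (P x)
        rwa [abs_of_nonpos hPx, mul_neg, ← neg_mul]
      · simp [hP0 x hx]
      · have hPx : 0 ≤ P x := nonneg_of_mul_nonneg_left (hPd x) hx
        have h1 : Tendsto (fun n : ℕ => (n : ℝ) * d x) atTop atTop :=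
          tendsto_natCast_atTop_atTop.atTop_mul_const hx
        have := ((Real.tendsto_arctan_atTop.mono_right nhdsWithin_le_nhds).comp h1).mul_const (P x)
        rwa [abs_of_nonneg hPx]
  have := le_of_tendsto hlim (Eventually.of_forall step)
  rw [intervalIntegral.integral_const_mul] at this
  exact le_of_mul_le_mul_left this hpi

/-- A classical periodic solution of `u' = p`, `h ξ' = u - F`, where `ξ` is the regularized flux
`W_ε'(p) + ε p`. -/
structure IsRegularizedSolution (W : ℝ → ℝ) (h ε : ℝ) (F u ξ p : ℝ → ℝ) : Prop where
  periodic_u : Function.Periodic u 1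
  periodic_flux : Function.Periodic ξ 1
  hasDerivAt_u : ∀ x, HasDerivAt u (p x) x
  hasDerivAt_flux : ∀ x, HasDerivAt ξ ((u x - F x) / h) x
  flux_eq : ∀ x, ξ x = centralSlope W ε (p x) + ε * p x
  continuous_slope : Continuous p

lemma exists_isRegularizedSolution {W : ℝ → ℝ} (hW : ConvexOn ℝ Set.univ W) {L : ℝ}
    (hL : ∀ x y, |W x - W y| ≤ L * |x - y|) {h ε : ℝ} (hh : 0 < h) (hε : 0 < ε) {F : ℝ → ℝ}
    (hF : Continuous F) (hFp : Function.Periodic F 1) :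
    ∃ u ξ p, IsRegularizedSolution W h ε F u ξ p := by
  obtain ⟨γ, c, hc, hγ, hβγ⟩ := exists_inverse_regularization hL hW hε
  obtain ⟨u, ξ, hu, hξ, hdu, hdξ⟩ :=
    exists_periodic_system hh (one_div_pos.2 hε) hc hF hFp hγ
  refine ⟨u, ξ, fun x => γ (ξ x), hu, hξ, hdu, hdξ, fun x => (hβγ _).symm, ?_⟩
  have hξc : Continuous ξ := continuous_iff_continuousAt.2 fun x => (hdξ x).continuousAt
  have hmono : Monotone γ := fun s t hst => by
    have := (hγ s t hst).1
    nlinarith [mul_nonneg hc.le (sub_nonneg.2 hst)]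
  have hγc : Continuous γ := by
    refine (LipschitzWith.of_dist_le_mul (K := (1 / ε).toNNReal) fun s t => ?_).continuous
    rw [Real.coe_toNNReal _ (one_div_pos.2 hε).le, Real.dist_eq, Real.dist_eq]
    rcases le_total s t with hst | hst
    · rw [abs_sub_comm, abs_sub_comm s, abs_of_nonneg (sub_nonneg.2 hst),
        abs_of_nonneg (sub_nonneg.2 (hmono hst))]
      exact (hγ s t hst).2
    · rw [abs_of_nonneg (sub_nonneg.2 hst), abs_of_nonneg (sub_nonneg.2 (hmono hst))]
      exact (hγ t s hst).2
  exact hγc.comp hξc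

lemma Function.Periodic.integral_comp_add {v : ℝ → ℝ} (hv : Function.Periodic v 1) (s : ℝ) :
    ∫ x in (0 : ℝ)..1, v (x + s) = ∫ x in (0 : ℝ)..1, v x := by
  rw [intervalIntegral.integral_comp_add_right v, zero_add, add_comm 1 s,
    hv.intervalIntegral_add_eq s 0, zero_add]

namespace IsRegularizedSolution

variable {W : ℝ → ℝ} {h ε : ℝ} {F g u ξ p : ℝ → ℝ}

lemma isPrimitive (hs : IsRegularizedSolution W h ε F u ξ p) : IsPrimitive u p :=
  .of_hasDerivAt hs.hasDerivAt_u hs.continuous_slope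

lemma isPrimitive_flux (hs : IsRegularizedSolution W h ε F u ξ p) (hF : Continuous F) :
    IsPrimitive ξ (fun x => (u x - F x) / h) := by
  have := hs.isPrimitive.continuous
  exact .of_hasDerivAt hs.hasDerivAt_flux (by fun_prop)

lemma periodic_slope (hs : IsRegularizedSolution W h ε F u ξ p) : Function.Periodic p 1 :=
  fun x => by
    have h1 := (hs.hasDerivAt_u (x + 1)).comp_add_const x 1
    rw [show (fun x => u (x + 1)) = u from funext hs.periodic_u] at h1
    exact h1.unique (hs.hasDerivAt_u x)

/-- The term `ε p` makes the regularized flux strongly monotone, with constant `ε`. This supplies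
the sign hypotheses of `integral_abs_le_of_sign`, including the one where the flux difference
vanishes. -/
lemma sign_flux (hW : ConvexOn ℝ Set.univ W) (hε : 0 < ε) (a b : ℝ) :
    0 ≤ (a - b) * ((centralSlope W ε a + ε * a) - (centralSlope W ε b + ε * b)) ∧
    ((centralSlope W ε a + ε * a) - (centralSlope W ε b + ε * b) = 0 → a - b = 0) := by
  have aux : ∀ a b, ε * (a - b) ^ 2 ≤
      (a - b) * ((centralSlope W ε a + ε * a) - (centralSlope W ε b + ε * b)) := fun a b => by
    have : 0 ≤ (a - b) * (centralSlope W ε a - centralSlope W ε b) := by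
      rcases le_total a b with hab | hab
      · exact mul_nonneg_of_nonpos_of_nonpos (sub_nonpos.2 hab)
          (sub_nonpos.2 (centralSlope_mono hW hε hab))
      · exact mul_nonneg (sub_nonneg.2 hab) (sub_nonneg.2 (centralSlope_mono hW hε hab))
    linarith
  refine ⟨(by positivity : 0 ≤ ε * (a - b) ^ 2).trans (aux a b), fun h0 => ?_⟩
  have := aux a b
  rw [h0, mul_zero] at this
  have h2 : (a - b) ^ 2 ≤ 0 := by nlinarith
  exact pow_eq_zero_iff two_ne_zero |>.1 (le_antisymm h2 (sq_nonneg _))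

/-- A constant slope has constant flux, so subtracting it does not change the derivative of the
flux. In the accretivity estimate `P - q` becomes `g - c`. -/
lemma integral_abs_sub_const_le (hs : IsRegularizedSolution W h ε F u ξ p)
    (hW : ConvexOn ℝ Set.univ W) (hh : 0 < h) (hε : 0 < ε) (hF : IsPrimitive F g)
    (hFp : Function.Periodic F 1) (c : ℝ) :
    ∫ x in (0 : ℝ)..1, |p x - c| ≤ ∫ x in (0 : ℝ)..1, |g x - c| := by
  have := integral_abs_le_of_sign hh (d := fun x => ξ x - (centralSlope W ε c + ε * c))
    (k := fun x => u x - F x) (q := fun x => p x - g x) (P := fun x => p x - c)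
    (fun x => by simp only [hs.periodic_flux x])
    (fun x => by simp only [hs.periodic_u x, hFp x])
    (fun x => (hs.hasDerivAt_flux x).sub_const _) (hs.isPrimitive.sub hF)
    ((hs.continuous_slope.sub continuous_const).intervalIntegrable _ _)
    (fun x => by rw [hs.flux_eq]; exact (sign_flux hW hε _ _).1)
    (fun x hx => by rw [hs.flux_eq] at hx; exact (sign_flux hW hε _ _).2 hx)
  convert! this using 3 with x
  congr 1; ring

/-- The equation is translation invariant, so accretivity applies to the difference of a solution
and its translate. The resulting equicontinuity in `L¹` does not depend on `ε`. -/
lemma integral_abs_translate_sub_le (hs : IsRegularizedSolution W h ε F u ξ p)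
    (hW : ConvexOn ℝ Set.univ W) (hh : 0 < h) (hε : 0 < ε) (hF : IsPrimitive F g)
    (hFp : Function.Periodic F 1) (s : ℝ) :
    ∫ x in (0 : ℝ)..1, |p (x + s) - p x| ≤ ∫ x in (0 : ℝ)..1, |g (x + s) - g x| := by
  have := integral_abs_le_of_sign hh (d := fun x => ξ (x + s) - ξ x)
    (k := fun x => (u (x + s) - F (x + s)) - (u x - F x))
    (q := fun x => (p (x + s) - g (x + s)) - (p x - g x)) (P := fun x => p (x + s) - p x)
    (fun x => by simp only [add_right_comm x 1 s, hs.periodic_flux x, hs.periodic_flux (x + s)])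
    (fun x => by simp only [add_right_comm x 1 s, hs.periodic_u x, hFp x, hs.periodic_u (x + s),
      hFp (x + s)])
    (fun x => by
      rw [sub_div]
      exact ((hs.hasDerivAt_flux (x + s)).comp_add_const x s).sub (hs.hasDerivAt_flux x))
    (((hs.isPrimitive.sub hF).comp_add s).sub (hs.isPrimitive.sub hF))
    (((hs.continuous_slope.comp (continuous_add_const s)).sub
      hs.continuous_slope).intervalIntegrable _ _)
    (fun x => by rw [hs.flux_eq, hs.flux_eq]; exact (sign_flux hW hε _ _).1)
    (fun x hx => by rw [hs.flux_eq, hs.flux_eq] at hx; exact (sign_flux hW hε _ _).2 hx)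
  convert! this using 3 with x
  congr 1; ring

lemma integral_abs_le (hs : IsRegularizedSolution W h ε F u ξ p)
    (hW : ConvexOn ℝ Set.univ W) (hh : 0 < h) (hε : 0 < ε) (hF : IsPrimitive F g)
    (hFp : Function.Periodic F 1) :
    ∫ x in (0 : ℝ)..1, |p x| ≤ ∫ x in (0 : ℝ)..1, |g x| := by
  simpa using hs.integral_abs_sub_const_le hW hh hε hF hFp 0

end IsRegularizedSolution

/-- A periodic function oscillates by at most the `L¹` norm of its derivative. -/
lemma IsPrimitive.abs_sub_le {G g : ℝ → ℝ} (hG : IsPrimitive G g) (hp : Function.Periodic G 1)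
    (x y : ℝ) : |G x - G y| ≤ ∫ t in (0 : ℝ)..1, |g t| := by
  have aux : ∀ x ∈ Set.Ico (0 : ℝ) 1, ∀ y ∈ Set.Ico (0 : ℝ) 1, y ≤ x →
      |G x - G y| ≤ ∫ t in (0 : ℝ)..1, |g t| := fun x hx y hy hyx => by
    rw [← hG.integral_eq y x]
    refine (intervalIntegral.abs_integral_le_integral_abs hyx).trans ?_
    exact intervalIntegral.integral_mono_interval hy.1 hyx hx.2.le
      (Eventually.of_forall fun t => abs_nonneg _) (hG.intervalIntegrable 0 1).abs
  obtain ⟨x', hx', hx⟩ := hp.exists_mem_Ico₀ one_pos x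
  obtain ⟨y', hy', hy⟩ := hp.exists_mem_Ico₀ one_pos y
  rw [hx, hy]
  rcases le_total y' x' with h | h
  · exact aux _ hx' _ hy' h
  · rw [abs_sub_comm]; exact aux _ hy' _ hx' h

namespace IsRegularizedSolution

variable {W : ℝ → ℝ} {h ε : ℝ} {F g u ξ p : ℝ → ℝ}

/-- By Rolle's theorem the periodic flux has a critical point, where `u = F`; from there `u` and `F`
each deviate by at most `∫|g|`. -/
lemma abs_sub_le (hs : IsRegularizedSolution W h ε F u ξ p)
    (hW : ConvexOn ℝ Set.univ W) (hh : 0 < h) (hε : 0 < ε) (hF : IsPrimitive F g)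
    (hFp : Function.Periodic F 1) (x : ℝ) :
    |u x - F x| ≤ 2 * ∫ x in (0 : ℝ)..1, |g x| := by
  have hξc := (hs.isPrimitive_flux hF.continuous).continuous
  obtain ⟨z, -, hz⟩ := exists_hasDerivAt_eq_zero (f := ξ) zero_lt_one hξc.continuousOn
    (by simpa using (hs.periodic_flux 0).symm) (fun x _ => hs.hasDerivAt_flux x)
  have hz' : u z = F z := by
    rcases div_eq_zero_iff.1 hz with hz | hz
    · linarith
    · exact absurd hz hh.ne'
  have h1 := hs.isPrimitive.abs_sub_le hs.periodic_u x z
  have h2 := hF.abs_sub_le hFp z x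
  have h3 := hs.integral_abs_le hW hh hε hF hFp
  have h4 := abs_add_le (u x - u z) (F z - F x)
  rw [show u x - u z + (F z - F x) = u x - F x by rw [hz']; ring] at h4
  linarith

lemma abs_flux_sub_le (hs : IsRegularizedSolution W h ε F u ξ p)
    (hW : ConvexOn ℝ Set.univ W) (hh : 0 < h) (hε : 0 < ε) (hF : IsPrimitive F g)
    (hFp : Function.Periodic F 1) (x y : ℝ) :
    |ξ x - ξ y| ≤ (2 * ∫ x in (0 : ℝ)..1, |g x|) / h * |x - y| := by
  have := Convex.norm_image_sub_le_of_norm_hasDerivWithin_le (f := ξ) (s := Set.univ)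
    (C := (2 * ∫ x in (0 : ℝ)..1, |g x|) / h) (fun x _ => (hs.hasDerivAt_flux x).hasDerivWithinAt)
    (fun x _ => by
      rw [Real.norm_eq_abs, abs_div, abs_of_pos hh]
      exact div_le_div_of_nonneg_right (hs.abs_sub_le hW hh hε hF hFp x) hh.le) convex_univ
    (Set.mem_univ y) (Set.mem_univ x)
  simpa [Real.norm_eq_abs] using this

/-- At a critical point of `u` the slope is zero, so the flux is the central slope at `0`, bounded
by `L`. The Lipschitz bound carries this over one period. -/
lemma abs_flux_le (hs : IsRegularizedSolution W h ε F u ξ p)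
    (hW : ConvexOn ℝ Set.univ W) {L : ℝ} (hL : ∀ x y, |W x - W y| ≤ L * |x - y|)
    (hh : 0 < h) (hε : 0 < ε) (hF : IsPrimitive F g) (hFp : Function.Periodic F 1) (x : ℝ) :
    |ξ x| ≤ L + (2 * ∫ x in (0 : ℝ)..1, |g x|) / h := by
  have huc := hs.isPrimitive.continuous
  obtain ⟨z, hz, hz0⟩ := exists_hasDerivAt_eq_zero (f := u) zero_lt_one huc.continuousOn
    (by simpa using (hs.periodic_u 0).symm) (fun x _ => hs.hasDerivAt_u x)
  have h1 : |ξ z| ≤ L := by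
    rw [hs.flux_eq, hz0, mul_zero, add_zero]; exact abs_centralSlope_le hL hε 0
  obtain ⟨y, hy, hxy⟩ := hs.periodic_flux.exists_mem_Ico₀ one_pos x
  have hA : 0 ≤ (2 * ∫ x in (0 : ℝ)..1, |g x|) / h := div_nonneg (mul_nonneg zero_le_two
    (intervalIntegral.integral_nonneg zero_le_one fun x _ => abs_nonneg _)) hh.le
  have h2 := hs.abs_flux_sub_le hW hh hε hF hFp y z
  have h3 : |y - z| ≤ 1 := abs_le.2 ⟨by linarith [hy.1, hz.2], by linarith [hy.2, hz.1]⟩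
  have h4 := mul_le_mul_of_nonneg_left h3 hA
  have h5 := abs_add_le (ξ z) (ξ y - ξ z)
  rw [add_sub_cancel] at h5
  rw [hxy]
  linarith

variable {ε' : ℝ} {u' ξ' p' : ℝ → ℝ}

/-- Interpolation between the fluxes and the slopes. -/
lemma integral_sq_sub_le (hs : IsRegularizedSolution W h ε F u ξ p)
    (hs' : IsRegularizedSolution W h ε' F u' ξ' p')
    (hW : ConvexOn ℝ Set.univ W) (hh : 0 < h) (hε : 0 < ε) (hε' : 0 < ε') (hF : IsPrimitive F g)
    (hFp : Function.Periodic F 1) {η : ℝ} (hη : ∀ x, |ξ x - ξ' x| ≤ η) :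
    ∫ x in (0 : ℝ)..1, (u x - u' x) ^ 2 ≤ h * η * (2 * ∫ x in (0 : ℝ)..1, |g x|) := by
  have hξ := (hs.isPrimitive_flux hF.continuous).sub (hs'.isPrimitive_flux hF.continuous)
  have hu := hs.isPrimitive.sub hs'.isPrimitive
  have hη0 : 0 ≤ η := (abs_nonneg _).trans (hη 0)
  have h1 := hξ.integral_mul_eq_neg hu
    (fun x => by simp only [hs.periodic_flux x, hs'.periodic_flux x])
    (fun x => by simp only [hs.periodic_u x, hs'.periodic_u x])
  -- The datum cancels: `u - u'` is `h` times the derivative of the flux difference, which is then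
  -- moved onto `u - u'` by parts.
  have h2 : ∫ x in (0 : ℝ)..1, (u x - u' x) ^ 2 =
      h * ∫ x in (0 : ℝ)..1, ((u x - F x) / h - (u' x - F x) / h) * (u x - u' x) := by
    rw [← intervalIntegral.integral_const_mul]
    congr 1; funext x; field_simp; ring
  rw [h2, h1, mul_assoc]
  refine mul_le_mul_of_nonneg_left ?_ hh.le
  refine (neg_le_abs _).trans ((intervalIntegral.abs_integral_le_integral_abs zero_le_one).trans ?_)
  have hc := hs.continuous_slope
  have hc' := hs'.continuous_slope
  have hξc := hξ.continuous
  calc ∫ x in (0 : ℝ)..1, |(ξ x - ξ' x) * (p x - p' x)|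
      ≤ ∫ x in (0 : ℝ)..1, η * (|p x| + |p' x|) := by
        refine intervalIntegral.integral_mono_on zero_le_one
          (Continuous.intervalIntegrable (by fun_prop) _ _)
          (Continuous.intervalIntegrable (by fun_prop) _ _) fun x _ => ?_
        rw [abs_mul]
        exact mul_le_mul (hη x) (abs_sub _ _) (abs_nonneg _) hη0
    _ = η * ((∫ x in (0 : ℝ)..1, |p x|) + ∫ x in (0 : ℝ)..1, |p' x|) := by
        rw [intervalIntegral.integral_const_mul, intervalIntegral.integral_add
          (hc.abs.intervalIntegrable _ _) (hc'.abs.intervalIntegrable _ _)]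
    _ ≤ _ := by
        refine mul_le_mul_of_nonneg_left ?_ hη0
        linarith [hs.integral_abs_le hW hh hε hF hFp, hs'.integral_abs_le hW hh hε' hF hFp]

/-- The left-hand integrand is the absolute value of an average-type integral of `p x - p (x + r)`
over `0 ≤ r ≤ s`. Fubini and the translation estimate bound it by the data alone, uniformly in `ε`.
-/
lemma integral_abs_mul_sub_le (hs : IsRegularizedSolution W h ε F u ξ p)
    (hW : ConvexOn ℝ Set.univ W) (hh : 0 < h) (hε : 0 < ε) (hF : IsPrimitive F g)
    (hFp : Function.Periodic F 1) {s om : ℝ} (hs0 : 0 ≤ s)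
    (hom : ∀ r, 0 ≤ r → r ≤ s → ∫ x in (0 : ℝ)..1, |g (x + r) - g x| ≤ om) :
    ∫ x in (0 : ℝ)..1, |s * p x - (u (x + s) - u x)| ≤ s * om := by
  have hc := hs.continuous_slope
  have huc := hs.isPrimitive.continuous
  have e : ∀ x, s * p x - (u (x + s) - u x) = ∫ r in (0 : ℝ)..s, (p x - p (x + r)) := fun x => by
    rw [intervalIntegral.integral_sub intervalIntegrable_const
      (Continuous.intervalIntegrable (by fun_prop) _ _), intervalIntegral.integral_const,
      intervalIntegral.integral_comp_add_left p, hs.isPrimitive.integral_eq]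
    simp
  have hjoint : Continuous fun z : ℝ × ℝ => |p z.1 - p (z.1 + z.2)| := by fun_prop
  calc ∫ x in (0 : ℝ)..1, |s * p x - (u (x + s) - u x)|
      ≤ ∫ x in (0 : ℝ)..1, ∫ r in (0 : ℝ)..s, |p x - p (x + r)| := by
        refine intervalIntegral.integral_mono_on zero_le_one
          (Continuous.intervalIntegrable (by fun_prop) _ _)
          (Continuous.intervalIntegrable ?_ _ _) fun x _ => ?_
        · exact intervalIntegral.continuous_parametric_intervalIntegral_of_continuous' hjoint _ _
        · rw [e]; exact intervalIntegral.abs_integral_le_integral_abs hs0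
    _ = ∫ r in (0 : ℝ)..s, ∫ x in (0 : ℝ)..1, |p x - p (x + r)| := by
        apply intervalIntegral_intervalIntegral_swap
        exact (hjoint.continuousOn.integrableOn_compact (isCompact_uIcc.prod isCompact_uIcc)).mono_set
          (Set.prod_mono Set.uIoc_subset_uIcc Set.uIoc_subset_uIcc)
    _ ≤ ∫ r in (0 : ℝ)..s, om := by
        refine intervalIntegral.integral_mono_on hs0 (Continuous.intervalIntegrable ?_ _ _)
          intervalIntegrable_const fun r hr => ?_
        · exact intervalIntegral.continuous_parametric_intervalIntegral_of_continuous'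
            (f := fun r x => |p x - p (x + r)|) (by fun_prop) _ _
        · simp_rw [abs_sub_comm (p _) (p (_ + r))]
          exact (hs.integral_abs_translate_sub_le hW hh hε hF hFp r).trans (hom r hr.1 hr.2)
    _ = s * om := by simp

/-- `L¹` distance of slopes, in terms of the `L¹` distance of the solutions and the modulus of
continuity of the data. -/
lemma integral_abs_slope_sub_le (hs : IsRegularizedSolution W h ε F u ξ p)
    (hs' : IsRegularizedSolution W h ε' F u' ξ' p')
    (hW : ConvexOn ℝ Set.univ W) (hh : 0 < h) (hε : 0 < ε) (hε' : 0 < ε') (hF : IsPrimitive F g)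
    (hFp : Function.Periodic F 1) {s om : ℝ} (hs0 : 0 ≤ s)
    (hom : ∀ r, 0 ≤ r → r ≤ s → ∫ x in (0 : ℝ)..1, |g (x + r) - g x| ≤ om) :
    s * ∫ x in (0 : ℝ)..1, |p x - p' x| ≤
      2 * (s * om) + 2 * ∫ x in (0 : ℝ)..1, |u x - u' x| := by
  have hc := hs.continuous_slope
  have hc' := hs'.continuous_slope
  have huc := hs.isPrimitive.continuous
  have huc' := hs'.isPrimitive.continuous
  have h1 := hs.integral_abs_mul_sub_le hW hh hε hF hFp hs0 hom
  have h2 := hs'.integral_abs_mul_sub_le hW hh hε' hF hFp hs0 hom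
  have h3 : ∫ x in (0 : ℝ)..1, |u (x + s) - u' (x + s)| = ∫ x in (0 : ℝ)..1, |u x - u' x| :=
    Function.Periodic.integral_comp_add (v := fun x => |u x - u' x|)
      (fun x => by simp only [hs.periodic_u x, hs'.periodic_u x]) s
  have key : ∫ x in (0 : ℝ)..1, s * |p x - p' x| ≤
      ∫ x in (0 : ℝ)..1, ((|s * p x - (u (x + s) - u x)| + |s * p' x - (u' (x + s) - u' x)|) +
        (|u (x + s) - u' (x + s)| + |u x - u' x|)) := by
    refine intervalIntegral.integral_mono_on zero_le_one
      (Continuous.intervalIntegrable (by fun_prop) _ _)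
      (Continuous.intervalIntegrable (by fun_prop) _ _) fun x _ => ?_
    rw [← abs_of_nonneg hs0, ← abs_mul, abs_of_nonneg hs0]
    have e1 := abs_sub (s * p x - (u (x + s) - u x)) (s * p' x - (u' (x + s) - u' x))
    have e2 := abs_sub (u (x + s) - u' (x + s)) (u x - u' x)
    have e3 := abs_add_le ((s * p x - (u (x + s) - u x)) - (s * p' x - (u' (x + s) - u' x)))
      ((u (x + s) - u' (x + s)) - (u x - u' x))
    rw [show (s * p x - (u (x + s) - u x)) - (s * p' x - (u' (x + s) - u' x)) +
      ((u (x + s) - u' (x + s)) - (u x - u' x)) = s * (p x - p' x) by ring] at e3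
    linarith
  rw [intervalIntegral.integral_const_mul, intervalIntegral.integral_add
    (Continuous.intervalIntegrable (by fun_prop) _ _)
    (Continuous.intervalIntegrable (by fun_prop) _ _), intervalIntegral.integral_add
    (Continuous.intervalIntegrable (by fun_prop) _ _)
    (Continuous.intervalIntegrable (by fun_prop) _ _), intervalIntegral.integral_add
    (Continuous.intervalIntegrable (by fun_prop) _ _)
    (Continuous.intervalIntegrable (by fun_prop) _ _), h3] at key
  linarith

end IsRegularizedSolution

/-! ### Compactness and passage to the limit -/

/-- Arzelà–Ascoli for periodic functions. -/
lemma exists_subseq_tendstoUniformly_of_periodic {ξ : ℕ → ℝ → ℝ} {K M : ℝ}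
    (hp : ∀ n, Function.Periodic (ξ n) 1) (hK : ∀ n x y, |ξ n x - ξ n y| ≤ K * |x - y|)
    (hM : ∀ n x, |ξ n x| ≤ M) :
    ∃ (φ : ℕ → ℕ) (η : ℝ → ℝ), StrictMono φ ∧ Function.Periodic η 1 ∧
      ∀ e > 0, ∃ N, ∀ n ≥ N, ∀ x, |ξ (φ n) x - η x| ≤ e := by
  have hK0 : 0 ≤ K := by simpa using (abs_nonneg _).trans (hK 0 1 0)
  have hlip : ∀ n, LipschitzWith K.toNNReal (fun x : Set.Icc (0 : ℝ) 1 => ξ n x) := fun n =>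
    .of_dist_le_mul fun x y => by
      rw [Real.coe_toNNReal _ hK0, Subtype.dist_eq, Real.dist_eq, Real.dist_eq]
      exact hK n x y
  set A : ℕ → BoundedContinuousFunction (Set.Icc (0 : ℝ) 1) ℝ := fun n =>
    BoundedContinuousFunction.mkOfCompact ⟨_, (hlip n).continuous⟩
  have hcomp : IsCompact (closure (Set.range A)) := by
    refine BoundedContinuousFunction.arzela_ascoli (Set.Icc (-M) M) isCompact_Icc _ ?_ ?_
    · rintro _ x ⟨n, rfl⟩
      exact abs_le.1 (hM n x)
    · apply UniformEquicontinuous.equicontinuous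
      rw [Metric.uniformEquicontinuous_iff]
      intro e he
      refine ⟨e / (K + 1), by positivity, ?_⟩
      rintro x y hxy ⟨_, n, rfl⟩
      change dist (ξ n x) (ξ n y) < e
      rw [lt_div_iff₀ (by positivity)] at hxy
      have := (hlip n).dist_le_mul x y
      rw [Real.coe_toNNReal _ hK0] at this
      refine this.trans_lt (lt_of_le_of_lt ?_ hxy)
      nlinarith [dist_nonneg (x := x) (y := y)]
  obtain ⟨η, -, φ, hφ, hlim⟩ :=
    hcomp.tendsto_subseq (fun n => subset_closure (Set.mem_range_self (f := A) n))
  have hmem : ∀ x : ℝ, Int.fract x ∈ Set.Icc (0 : ℝ) 1 := fun x =>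
    ⟨Int.fract_nonneg x, (Int.fract_lt_one x).le⟩
  refine ⟨φ, fun x => η ⟨Int.fract x, hmem x⟩, hφ, fun x => by simp only [Int.fract_add_one],
    fun e he => ?_⟩
  obtain ⟨N, hN⟩ := Metric.tendsto_atTop.1 hlim e he
  refine ⟨N, fun n hn x => ?_⟩
  have h1 := BoundedContinuousFunction.dist_coe_le_dist (f := A (φ n)) (g := η) ⟨Int.fract x, hmem x⟩
  rw [Real.dist_eq] at h1
  have h2 : A (φ n) ⟨Int.fract x, hmem x⟩ = ξ (φ n) x := by
    change ξ (φ n) (Int.fract x) = ξ (φ n) x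
    have := (hp (φ n)).sub_int_mul_eq ⌊x⌋ (x := x)
    rwa [mul_one] at this
  rw [h2] at h1
  exact h1.trans (hN n hn).le

lemma torus_integral_const (c : ℝ) : ∫ _ : UnitAddCircle, c = c := by
  rw [torus_integral_eq]; simp

/-- Translation is continuous in `L¹` of the circle. -/
lemma exists_integral_translate_sub_le {g : UnitAddCircle → ℝ} (hg : Integrable g) {e : ℝ}
    (he : 0 < e) : ∃ s > 0, ∀ r : ℝ, 0 ≤ r → r ≤ s →
      ∫ x, |g (x + (r : UnitAddCircle)) - g x| ≤ e := by
  obtain ⟨k, hk, hki⟩ := hg.exists_boundedContinuous_integral_sub_le (by positivity : 0 < e / 3)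
  have huc := CompactSpace.uniformContinuous_of_continuous k.continuous
  obtain ⟨δ, hδ, hδk⟩ := Metric.uniformContinuous_iff.1 huc (e / 3) (by positivity)
  refine ⟨δ / 2, by positivity, fun r hr0 hr => ?_⟩
  have hnorm : ‖(r : UnitAddCircle)‖ < δ := by
    refine lt_of_le_of_lt (QuotientAddGroup.norm_mk_le_norm
      (S := AddSubgroup.zmultiples (1 : ℝ)) (m := r)) ?_
    rw [Real.norm_eq_abs, abs_of_nonneg hr0]; linarith
  have hgt : Integrable fun x => g (x + (r : UnitAddCircle)) := hg.comp_add_right _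
  have hkt : Integrable fun x => k (x + (r : UnitAddCircle)) := hki.comp_add_right _
  have i1 : Integrable fun x => |g (x + (r : UnitAddCircle)) - k (x + (r : UnitAddCircle))| :=
    (hgt.sub hkt).abs
  have i2 : Integrable fun x => |g x - k x| := (hg.sub hki).abs
  have i12 : Integrable fun x => |g (x + (r : UnitAddCircle)) - k (x + (r : UnitAddCircle))| +
    |g x - k x| := i1.add i2
  have h1 : ∫ x, |g (x + (r : UnitAddCircle)) - k (x + (r : UnitAddCircle))| ≤ e / 3 := by
    rw [integral_add_right_eq_self (fun x => |g x - k x|)]; exact hk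
  have h2 : ∫ x, |g (x + (r : UnitAddCircle)) - g x| ≤
      ∫ x, ((|g (x + (r : UnitAddCircle)) - k (x + (r : UnitAddCircle))| + |g x - k x|) + e / 3) := by
    refine integral_mono (hgt.sub hg).abs (i12.add (integrable_const _)) fun x => ?_
    have h3 : |k (x + (r : UnitAddCircle)) - k x| ≤ e / 3 := by
      rw [← Real.dist_eq]
      refine (hδk ?_).le
      rw [dist_eq_norm, add_sub_cancel_left]; exact hnorm
    have h4 := abs_le.1 h3
    have h5 := abs_le.1 (le_refl |g (x + (r : UnitAddCircle)) - k (x + (r : UnitAddCircle))|)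
    have h6 := abs_le.1 (le_refl |g x - k x|)
    exact abs_le.2 ⟨by linarith, by linarith⟩
  rw [integral_add i12 (integrable_const _), integral_add i1 i2] at h2
  rw [torus_integral_const] at h2
  have hk' : ∫ x, |g x - k x| ≤ e / 3 := hk
  linarith

section L1

variable {α : Type*} [MeasurableSpace α] {μ : Measure α}

/-- Completeness of `L¹`, for sequences of functions. -/
lemma exists_tendsto_integral_abs_sub {v : ℕ → α → ℝ} (hv : ∀ n, Integrable (v n) μ)
    (hc : ∀ e > 0, ∃ N, ∀ n ≥ N, ∀ m ≥ N, ∫ x, |v n x - v m x| ∂μ ≤ e) :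
    ∃ w : α → ℝ, Integrable w μ ∧ Tendsto (fun n => ∫ x, |v n x - w x| ∂μ) atTop (𝓝 0) := by
  have hdist : ∀ f k : α → ℝ, ∀ (hf : Integrable f μ) (hk : Integrable k μ),
      dist (hf.toL1 f) (hk.toL1 k) = ∫ x, |f x - k x| ∂μ := fun f k hf hk => by
    rw [dist_eq_norm, ← Integrable.toL1_sub, L1.norm_eq_integral_norm]
    refine integral_congr_ae ?_
    filter_upwards [Integrable.coeFn_toL1 (hf.sub hk)] with x hx
    rw [hx, Real.norm_eq_abs, Pi.sub_apply]
  have hcs : CauchySeq fun n => (hv n).toL1 (v n) := by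
    refine Metric.cauchySeq_iff.2 fun e he => ?_
    obtain ⟨N, hN⟩ := hc (e / 2) (by positivity)
    refine ⟨N, fun m hm n hn => ?_⟩
    rw [hdist]
    linarith [hN m hm n hn]
  obtain ⟨w, hw⟩ := cauchySeq_tendsto_of_complete hcs
  refine ⟨w, L1.integrable_coeFn w, ?_⟩
  have := tendsto_iff_dist_tendsto_zero.1 hw
  refine this.congr fun n => ?_
  conv_lhs => rw [← Integrable.toL1_coeFn w (L1.integrable_coeFn w)]
  rw [hdist]

lemma exists_subseq_ae_tendsto_of_integral_abs_sub {v : ℕ → α → ℝ} {w : α → ℝ}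
    (hv : ∀ n, Integrable (v n) μ) (hw : Integrable w μ)
    (h : Tendsto (fun n => ∫ x, |v n x - w x| ∂μ) atTop (𝓝 0)) :
    ∃ φ : ℕ → ℕ, StrictMono φ ∧ ∀ᵐ x ∂μ, Tendsto (fun n => v (φ n) x) atTop (𝓝 (w x)) := by
  have h1 : Tendsto (fun n => eLpNorm (v n - w) 1 μ) atTop (𝓝 0) := by
    have h2 : ∀ n, eLpNorm (v n - w) 1 μ = ENNReal.ofReal (∫ x, |v n x - w x| ∂μ) := fun n => by
      rw [eLpNorm_one_eq_lintegral_enorm, ← ofReal_integral_norm_eq_lintegral_enorm ((hv n).sub hw)]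
      rfl
    simp_rw [h2]
    simpa using ENNReal.tendsto_ofReal h
  exact (tendstoInMeasure_of_tendsto_eLpNorm one_ne_zero (fun n => (hv n).aestronglyMeasurable)
    hw.aestronglyMeasurable h1).exists_seq_tendsto_ae

end L1

lemma tendsto_integral_mul_of_integral_abs_sub {v : ℕ → UnitAddCircle → ℝ} {w : UnitAddCircle → ℝ}
    (hv : ∀ n, Integrable (v n)) (hw : Integrable w)
    (h : Tendsto (fun n => ∫ x, |v n x - w x|) atTop (𝓝 0)) {ψ : UnitAddCircle → ℝ}
    (hψ : Continuous ψ) : Tendsto (fun n => ∫ x, v n x * ψ x) atTop (𝓝 (∫ x, w x * ψ x)) := by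
  obtain ⟨C, hC⟩ := isCompact_univ.exists_bound_of_continuousOn hψ.continuousOn
  rw [tendsto_iff_dist_tendsto_zero]
  refine squeeze_zero (fun n => dist_nonneg) (fun n => ?_) (by simpa using h.mul_const C)
  rw [Real.dist_eq, ← integral_sub ((hv n).mul_continuous hψ) (hw.mul_continuous hψ),
    ← integral_mul_const]
  refine abs_integral_le_integral_abs.trans
    (integral_mono (((hv n).mul_continuous hψ).sub (hw.mul_continuous hψ)).abs
      (((hv n).sub hw).abs.mul_const C) fun x => ?_)
  simp only
  rw [← sub_mul, abs_mul]
  exact mul_le_mul_of_nonneg_left (hC x trivial) (abs_nonneg _)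

lemma hasWeakDeriv_of_tendsto {v k : ℕ → UnitAddCircle → ℝ} {w l : UnitAddCircle → ℝ}
    (hv : ∀ n, Integrable (v n)) (hw : Integrable w)
    (h : Tendsto (fun n => ∫ x, |v n x - w x|) atTop (𝓝 0))
    (hk : ∀ n, Integrable (k n)) (hl : Integrable l)
    (h' : Tendsto (fun n => ∫ x, |k n x - l x|) atTop (𝓝 0))
    (hd : ∀ n, HasWeakDeriv (v n) (k n)) : HasWeakDeriv w l := by
  intro φ hφ
  refine tendsto_nhds_unique (tendsto_integral_mul_of_integral_abs_sub hv hw h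
    hφ.continuous_torusDeriv) ?_
  simp_rw [fun n => hd n φ hφ]
  exact (tendsto_integral_mul_of_integral_abs_sub hk hl h' hφ.continuous).neg

lemma integrable_of_continuous {v : UnitAddCircle → ℝ} (hv : Continuous v) : Integrable v :=
  hv.integrable_of_hasCompactSupport (HasCompactSupport.of_compactSpace _)

/-- The pointwise bound `|v| ≤ δ + v² / δ` takes the place of the Cauchy–Schwarz inequality. -/
lemma integral_abs_le_add_integral_sq {v : ℝ → ℝ} (hv : Continuous v) {δ : ℝ} (hδ : 0 < δ) :
    ∫ x in (0 : ℝ)..1, |v x| ≤ δ + (∫ x in (0 : ℝ)..1, v x ^ 2) / δ := by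
  have h1 : ∫ x in (0 : ℝ)..1, |v x| ≤ ∫ x in (0 : ℝ)..1, (δ + v x ^ 2 / δ) := by
    refine intervalIntegral.integral_mono_on zero_le_one (hv.abs.intervalIntegrable _ _)
      (Continuous.intervalIntegrable (by fun_prop) _ _) fun x _ => ?_
    rw [← sub_le_iff_le_add', le_div_iff₀ hδ, ← sq_abs (v x)]
    nlinarith [sq_nonneg (|v x| - δ), abs_nonneg (v x), hδ, mul_nonneg (abs_nonneg (v x)) hδ.le]
  rw [intervalIntegral.integral_add intervalIntegrable_const
    (Continuous.intervalIntegrable (by fun_prop) _ _), intervalIntegral.integral_div] at h1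
  simpa using h1

lemma IsRegularizedSolution.exists_torus {W : ℝ → ℝ} {h ε : ℝ} {F u ξ p : ℝ → ℝ}
    (hs : IsRegularizedSolution W h ε F u ξ p) (hF : Continuous F) :
    ∃ U X P : UnitAddCircle → ℝ, Continuous U ∧ Continuous X ∧ Continuous P ∧
      IsRegularizedSolution W h ε F (fun t : ℝ => U t) (fun t : ℝ => X t) (fun t : ℝ => P t) :=
  ⟨hs.periodic_u.lift, hs.periodic_flux.lift, hs.periodic_slope.lift,
    continuous_of_comp_coe hs.isPrimitive.continuous,
    continuous_of_comp_coe (hs.isPrimitive_flux hF).continuous,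
    continuous_of_comp_coe hs.continuous_slope, hs⟩

/-- A sequence of regularized solutions, with parameters tending to zero and uniformly convergent
fluxes. -/
structure IsApproximation (W : ℝ → ℝ) (h : ℝ) (F g : UnitAddCircle → ℝ) (ε : ℕ → ℝ)
    (U X P : ℕ → UnitAddCircle → ℝ) (ξ : UnitAddCircle → ℝ) : Prop where
  pos : ∀ n, 0 < ε n
  tendsto_param : Tendsto ε atTop (𝓝 0)
  isPrimitive : IsPrimitive (fun t : ℝ => F t) (fun t : ℝ => g t)
  continuous_u : ∀ n, Continuous (U n)
  continuous_flux : ∀ n, Continuous (X n)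
  continuous_slope : ∀ n, Continuous (P n)
  solution : ∀ n, IsRegularizedSolution W h (ε n) (fun t : ℝ => F t) (fun t : ℝ => U n t)
    (fun t : ℝ => X n t) (fun t : ℝ => P n t)
  uniform : ∀ e > 0, ∃ N, ∀ n ≥ N, ∀ x, |X n x - ξ x| ≤ e

lemma exists_isApproximation {W : ℝ → ℝ} (hW : ConvexOn ℝ Set.univ W) {L : ℝ}
    (hL : ∀ x y, |W x - W y| ≤ L * |x - y|) {h : ℝ} (hh : 0 < h) {F g : UnitAddCircle → ℝ}
    (hF : IsPrimitive (fun t : ℝ => F t) (fun t : ℝ => g t)) :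
    ∃ ε U X P ξ, IsApproximation W h F g ε U X P ξ := by
  have hε : ∀ n : ℕ, 0 < 1 / ((n : ℝ) + 1) := fun n => Nat.one_div_pos_of_nat
  have hFp := periodic_comp_coe F
  have hex : ∀ n : ℕ, ∃ U X P : UnitAddCircle → ℝ, Continuous U ∧ Continuous X ∧ Continuous P ∧
      IsRegularizedSolution W h (1 / ((n : ℝ) + 1)) (fun t : ℝ => F t) (fun t : ℝ => U t)
        (fun t : ℝ => X t) (fun t : ℝ => P t) := fun n => by
    obtain ⟨u, ξ, p, hs⟩ := exists_isRegularizedSolution hW hL hh (hε n) hF.continuous hFp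
    exact hs.exists_torus hF.continuous
  choose U X P hU hX hP hs using hex
  obtain ⟨φ, η, hφ, hη, hlim⟩ := exists_subseq_tendstoUniformly_of_periodic
    (fun n => periodic_comp_coe (X n))
    (fun n => (hs n).abs_flux_sub_le hW hh (hε n) hF hFp)
    (fun n => (hs n).abs_flux_le hW hL hh (hε n) hF hFp)
  refine ⟨fun n => 1 / ((φ n : ℝ) + 1), fun n => U (φ n), fun n => X (φ n), fun n => P (φ n),
    hη.lift, fun n => hε _, ?_, hF, fun n => hU _, fun n => hX _, fun n => hP _, fun n => hs _,
    fun e he => ?_⟩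
  · exact tendsto_one_div_add_atTop_nhds_zero_nat.comp hφ.tendsto_atTop
  · obtain ⟨N, hN⟩ := hlim e he
    refine ⟨N, fun n hn x => ?_⟩
    induction x using QuotientAddGroup.induction_on with
    | H y => exact hN n hn y

namespace IsApproximation

variable {W : ℝ → ℝ} {h : ℝ} {F g : UnitAddCircle → ℝ} {ε : ℕ → ℝ}
  {U X P : ℕ → UnitAddCircle → ℝ} {ξ : UnitAddCircle → ℝ}

lemma integral_abs_nonneg (g : UnitAddCircle → ℝ) : 0 ≤ ∫ x in (0 : ℝ)..1, |g x| :=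
  intervalIntegral.integral_nonneg zero_le_one fun _ _ => abs_nonneg _

lemma cauchy_u (ha : IsApproximation W h F g ε U X P ξ) (hW : ConvexOn ℝ Set.univ W)
    (hh : 0 < h) (e : ℝ) (he : 0 < e) :
    ∃ N, ∀ n ≥ N, ∀ m ≥ N, ∫ x, |U n x - U m x| ≤ e := by
  set A := ∫ x in (0 : ℝ)..1, |g x| with hA
  have hA0 : 0 ≤ A := integral_abs_nonneg g
  -- With fluxes within `e² / (4B)` of the limit, the squared `L²` distance is at most `(4hA /
  -- B)(e/2)² ≤ (e/2)²`; the summand `1` keeps `B` positive when `A = 0`.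
  set B := 4 * h * A + 1 with hB
  have hB0 : 0 < B := by positivity
  obtain ⟨N, hN⟩ := ha.uniform (e ^ 2 / (4 * B)) (by positivity)
  refine ⟨N, fun n hn m hm => ?_⟩
  have hsub : ∀ x : ℝ, |X n x - X m x| ≤ 2 * (e ^ 2 / (4 * B)) := fun x => by
    have h1 := abs_le.1 (hN n hn x)
    have h2 := abs_le.1 (hN m hm x)
    exact abs_le.2 ⟨by linarith, by linarith⟩
  have h1 := (ha.solution n).integral_sq_sub_le (ha.solution m) hW hh (ha.pos n) (ha.pos m)
    ha.isPrimitive (periodic_comp_coe F) hsub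
  have hc := (ha.solution n).isPrimitive.continuous
  have hc' := (ha.solution m).isPrimitive.continuous
  have h2 := integral_abs_le_add_integral_sq (hc.sub hc') (half_pos he)
  rw [torus_integral_eq]
  refine h2.trans ?_
  have h3 : (∫ x in (0 : ℝ)..1, (U n x - U m x) ^ 2) ≤ e / 2 * (e / 2) := by
    refine h1.trans ?_
    rw [show h * (2 * (e ^ 2 / (4 * B))) * (2 * A) = (4 * h * A) / B * (e / 2 * (e / 2)) by
      field_simp; ring]
    refine mul_le_of_le_one_left (by positivity) ((div_le_one hB0).2 (by linarith))
  have h4 := (div_le_iff₀ (half_pos he)).2 h3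
  simp only [Pi.sub_apply] at h4 ⊢
  linarith

/-- The step `s` is fixed first by the continuity of translations of `g`; only then is `N` chosen,
so that the `L¹` distance of the solutions is small compared with `s`. -/
lemma cauchy_slope (ha : IsApproximation W h F g ε U X P ξ) (hg : Integrable g)
    (hW : ConvexOn ℝ Set.univ W) (hh : 0 < h) (e : ℝ) (he : 0 < e) :
    ∃ N, ∀ n ≥ N, ∀ m ≥ N, ∫ x, |P n x - P m x| ≤ e := by
  obtain ⟨s, hs, hom⟩ := exists_integral_translate_sub_le hg (by positivity : 0 < e / 4)
  obtain ⟨N, hN⟩ := ha.cauchy_u hW hh (s * (e / 4)) (by positivity)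
  refine ⟨N, fun n hn m hm => ?_⟩
  have h1 := (ha.solution n).integral_abs_slope_sub_le (ha.solution m) hW hh (ha.pos n) (ha.pos m)
    ha.isPrimitive (periodic_comp_coe F) hs.le (om := e / 4) (fun r hr0 hr => by
      have := hom r hr0 hr
      rw [torus_integral_eq] at this
      simpa only [AddCircle.coe_add] using this)
  have h2 := hN n hn m hm
  rw [torus_integral_eq] at h2 ⊢
  refine le_of_mul_le_mul_left (h1.trans ?_) hs
  linarith

end IsApproximation

/-- Existence for the limit problem. -/
theorem exists_solution {W : ℝ → ℝ} (hW : ConvexOn ℝ Set.univ W) {L : ℝ}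
    (hL : ∀ x y, |W x - W y| ≤ L * |x - y|) {h : ℝ} (hh : 0 < h) {F g : UnitAddCircle → ℝ}
    (hFc : Continuous F) (hg : Integrable g)
    (hF : IsPrimitive (fun t : ℝ => F t) (fun t : ℝ => g t)) :
    ∃ u p ξ : UnitAddCircle → ℝ, IsW11 u p ∧ Continuous ξ ∧
      HasWeakDeriv ξ (fun x => (u x - F x) / h) ∧
      (∃ C, ∀ᵐ x, |u x - F x| ≤ C) ∧
      (∀ᵐ x, ξ x ∈ subdifferential W (p x)) ∧
      ∀ c : ℝ, ∫ x, |p x - c| ≤ ∫ x, |g x - c| := by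
  obtain ⟨ε, U, X, P, ξ, ha⟩ := exists_isApproximation hW hL hh hF
  have hFp := periodic_comp_coe F
  have hUi := fun n => integrable_of_continuous (ha.continuous_u n)
  have hPi := fun n => integrable_of_continuous (ha.continuous_slope n)
  have hFi := integrable_of_continuous hFc
  obtain ⟨u, hu, hulim⟩ := exists_tendsto_integral_abs_sub hUi (ha.cauchy_u hW hh)
  obtain ⟨p, hp, hplim⟩ := exists_tendsto_integral_abs_sub hPi (ha.cauchy_slope hg hW hh)
  have hξc : Continuous ξ := by
    have : TendstoUniformly X ξ atTop := by
      rw [Metric.tendstoUniformly_iff]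
      intro e he
      obtain ⟨N, hN⟩ := ha.uniform (e / 2) (by positivity)
      filter_upwards [eventually_ge_atTop N] with n hn x
      rw [dist_comm, Real.dist_eq]
      linarith [hN n hn x]
    exact this.continuous (Frequently.of_forall ha.continuous_flux)
  have hξi := integrable_of_continuous hξc
  have hXi := fun n => integrable_of_continuous (ha.continuous_flux n)
  have hXpt : ∀ x, Tendsto (fun n => X n x) atTop (𝓝 (ξ x)) := fun x => by
    rw [Metric.tendsto_atTop]
    intro e he
    obtain ⟨N, hN⟩ := ha.uniform (e / 2) (by positivity)
    refine ⟨N, fun n hn => ?_⟩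
    rw [Real.dist_eq]
    linarith [hN n hn x]
  have hXlim : Tendsto (fun n => ∫ x, |X n x - ξ x|) atTop (𝓝 0) := by
    rw [Metric.tendsto_atTop]
    intro e he
    obtain ⟨N, hN⟩ := ha.uniform (e / 2) (by positivity)
    refine ⟨N, fun n hn => ?_⟩
    have h1 : ∫ x, |X n x - ξ x| ≤ ∫ _ : UnitAddCircle, e / 2 :=
      integral_mono ((hXi n).sub hξi).abs (integrable_const _) fun x => hN n hn x
    rw [torus_integral_const] at h1
    rw [Real.dist_eq, sub_zero, abs_of_nonneg (integral_nonneg fun x => abs_nonneg _)]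
    linarith
  refine ⟨u, p, ξ, ⟨hu, hp, ?_⟩, hξc, ?_, ?_, ?_, fun c => ?_⟩
  · exact hasWeakDeriv_of_tendsto hUi hu hulim hPi hp hplim fun n =>
      hasWeakDeriv_of_isPrimitive (ha.solution n).isPrimitive
  · refine hasWeakDeriv_of_tendsto (k := fun n x => (U n x - F x) / h) hXi hξi hXlim
      (fun n => ((hUi n).sub hFi).div_const h) ((hu.sub hFi).div_const h) ?_ fun n =>
      hasWeakDeriv_of_isPrimitive ((ha.solution n).isPrimitive_flux hF.continuous)
    have := hulim.div_const h
    rw [zero_div] at this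
    refine this.congr fun n => ?_
    rw [← integral_div]
    refine integral_congr_ae (Eventually.of_forall fun x => ?_)
    simp only
    rw [← sub_div, abs_div, abs_of_pos hh, sub_sub_sub_cancel_right]
  -- The uniform bound on `U n - F` survives at almost every point along a subsequence.
  · obtain ⟨φ, -, hφlim⟩ := exists_subseq_ae_tendsto_of_integral_abs_sub hUi hu hulim
    refine ⟨2 * ∫ x in (0 : ℝ)..1, |g x|, ?_⟩
    filter_upwards [hφlim] with x hx
    refine le_of_tendsto (hx.sub_const (F x)).abs (Eventually.of_forall fun n => ?_)
    induction x using QuotientAddGroup.induction_on with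
    | H y => exact (ha.solution (φ n)).abs_sub_le hW hh (ha.pos _) hF hFp y
  · obtain ⟨φ, hφ, hφlim⟩ := exists_subseq_ae_tendsto_of_integral_abs_sub hPi hp hplim
    filter_upwards [hφlim] with x hx q
    have hWc := continuous_of_lipschitz_bound hL
    have hε0 := ha.tendsto_param.comp hφ.tendsto_atTop
    have hξ0 := (hXpt x).comp hφ.tendsto_atTop
    -- Removing `ε P` from the flux leaves the central slope, a subgradient up to `2Lε`. Both
    -- corrections vanish in the limit because `P (φ n) x` converges.
    have hlim : Tendsto (fun n => W (P (φ n) x) + (X (φ n) x - ε (φ n) * P (φ n) x) *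
        (q - P (φ n) x) - 2 * L * ε (φ n)) atTop
        (𝓝 (W (p x) + (ξ x - 0 * p x) * (q - p x) - 2 * L * 0)) :=
      (((hWc.tendsto _).comp hx).add ((hξ0.sub (hε0.mul hx)).mul
        (tendsto_const_nhds.sub hx))).sub (hε0.const_mul (2 * L))
    rw [zero_mul, sub_zero, mul_zero, sub_zero] at hlim
    refine le_of_tendsto hlim (Eventually.of_forall fun n => ?_)
    have hflux : X (φ n) x = centralSlope W (ε (φ n)) (P (φ n) x) + ε (φ n) * P (φ n) x := by
      induction x using QuotientAddGroup.induction_on with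
      | H y => exact (ha.solution (φ n)).flux_eq y
    rw [hflux, add_sub_cancel_right]
    exact le_of_centralSlope hL hW (ha.pos _) _ _
  · have hlim : Tendsto (fun n => (∫ x, |P n x - p x|) + ∫ x, |g x - c|) atTop
        (𝓝 (0 + ∫ x, |g x - c|)) := hplim.add_const _
    rw [zero_add] at hlim
    refine ge_of_tendsto hlim (Eventually.of_forall fun n => ?_)
    have h1 := (ha.solution n).integral_abs_sub_const_le hW hh (ha.pos n) hF hFp c
    rw [torus_integral_eq fun x => |g x - c|]
    refine le_trans ?_ (add_le_add_right h1 _)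
    rw [← torus_integral_eq fun x => |P n x - c|]
    have i1 : Integrable fun x => |P n x - p x| := ((hPi n).sub hp).abs
    have i2 : Integrable fun x => |P n x - c| := ((hPi n).sub (integrable_const c)).abs
    rw [← integral_add i1 i2]
    refine integral_mono (hp.sub (integrable_const c)).abs (i1.add i2) fun x => ?_
    simp only
    rw [abs_sub_comm (P n x) (p x)]
    exact abs_sub_le _ _ _

/-! ### Convex ordering through Taylor's formula -/

/-- The kernel of the second-order Taylor formula at `0`. -/
noncomputable def taylorKernel (k x : ℝ) : ℝ :=
  (|x - k| - |k| + (if 0 < k then x else -x)) / 2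

lemma measurable_taylorKernel : Measurable (Function.uncurry taylorKernel) := by
  have h1 : Measurable fun z : ℝ × ℝ => if 0 < z.1 then z.2 else -z.2 :=
    Measurable.ite (measurableSet_lt measurable_const measurable_fst) measurable_snd
      measurable_snd.neg
  have h2 : Measurable fun z : ℝ × ℝ => |z.2 - z.1| - |z.1| := by fun_prop
  exact (h2.add h1).div_const 2

/-- For `0 < k` the kernel is `(x - k)⁺`, and for `k ≤ 0` it is `(k - x)⁺`. Thus for `x ≥ 0` only
`k` between `0` and `x` contribute. -/
lemma taylorKernel_of_nonneg {x : ℝ} (hx : 0 ≤ x) (k : ℝ) :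
    taylorKernel k x = (Set.Ioc 0 x).indicator (fun k => x - k) k := by
  rw [taylorKernel, Set.indicator_apply]
  split_ifs with h1 h2 h2
  · rw [abs_of_nonneg (sub_nonneg.2 h2.2), abs_of_pos h1]; ring
  · have : x < k := by
      by_contra h; exact h2 ⟨h1, not_lt.1 h⟩
    rw [abs_of_neg (sub_neg.2 this), abs_of_pos h1]; ring
  · exact absurd h2.1 h1
  · have h3 := not_lt.1 h1
    rw [abs_of_nonneg (by linarith), abs_of_nonpos h3]; ring

lemma taylorKernel_of_nonpos {x : ℝ} (hx : x ≤ 0) (k : ℝ) :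
    taylorKernel k x = (Set.Ioc x 0).indicator (fun k => k - x) k := by
  rw [taylorKernel, Set.indicator_apply]
  split_ifs with h1 h2 h2
  · exact absurd h1 (not_lt.2 h2.2)
  · rw [abs_of_nonpos (by linarith), abs_of_pos h1]; ring
  · rw [abs_of_neg (sub_neg.2 h2.1), abs_of_nonpos h2.2]; ring
  · have : k ≤ x := by
      by_contra h; exact h2 ⟨not_le.1 h, not_lt.1 h1⟩
    rw [abs_of_nonneg (by linarith), abs_of_nonpos (this.trans hx)]; ring

lemma taylorKernel_nonneg (k x : ℝ) : 0 ≤ taylorKernel k x := by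
  rcases le_total 0 x with hx | hx
  · rw [taylorKernel_of_nonneg hx]
    exact Set.indicator_nonneg (fun k hk => sub_nonneg.2 hk.2) k
  · rw [taylorKernel_of_nonpos hx]
    exact Set.indicator_nonneg (fun k hk => sub_nonneg.2 hk.1.le) k

section Taylor

variable {Φ : ℝ → ℝ}

lemma hasDerivAt_of_contDiff (hΦ : ContDiff ℝ ∞ Φ) (x : ℝ) : HasDerivAt Φ (deriv Φ x) x :=
  (hΦ.differentiable (by simp) x).hasDerivAt

lemma contDiff_deriv (hΦ : ContDiff ℝ ∞ Φ) : ContDiff ℝ ∞ (deriv Φ) :=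
  (contDiff_infty_iff_deriv.1 hΦ).2

lemma deriv_deriv_nonneg (hΦ : ContDiff ℝ ∞ Φ) (hc : ConvexOn ℝ Set.univ Φ) (x : ℝ) :
    0 ≤ deriv (deriv Φ) x :=
  (monotoneOn_univ.1 (hc.monotoneOn_deriv fun x _ => hΦ.differentiable (by simp) x)).deriv_nonneg

lemma integral_taylor (hΦ : ContDiff ℝ ∞ Φ) (x : ℝ) :
    ∫ k in (0 : ℝ)..x, (x - k) * deriv (deriv Φ) k = Φ x - Φ 0 - deriv Φ 0 * x := by
  have h1 := hasDerivAt_of_contDiff hΦ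
  have h2 := hasDerivAt_of_contDiff (contDiff_deriv hΦ)
  have h3 := (contDiff_deriv (contDiff_deriv hΦ)).continuous
  rw [intervalIntegral.integral_eq_sub_of_hasDerivAt
    (f := fun k => (x - k) * deriv Φ k + Φ k) (fun k _ => ?_)
    (Continuous.intervalIntegrable (by fun_prop) _ _)]
  · ring
  · convert! (((hasDerivAt_id k).const_sub x).mul (h2 k)).add (h1 k) using 1
    simp only [id]
    ring

/-- A smooth convex function, up to its tangent at `0`, as a mixture of elementary convex
functions. -/
lemma lintegral_taylorKernel (hΦ : ContDiff ℝ ∞ Φ) (hc : ConvexOn ℝ Set.univ Φ) (x : ℝ) :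
    ∫⁻ k, ENNReal.ofReal (deriv (deriv Φ) k) * ENNReal.ofReal (taylorKernel k x) =
      ENNReal.ofReal (Φ x - Φ 0 - deriv Φ 0 * x) := by
  have hnn := deriv_deriv_nonneg hΦ hc
  have h3 := (contDiff_deriv (contDiff_deriv hΦ)).continuous
  simp_rw [← ENNReal.ofReal_mul (hnn _)]
  rcases le_total 0 x with hx | hx
  · have e : ∀ k, ENNReal.ofReal (deriv (deriv Φ) k * taylorKernel k x) =
        (Set.Ioc 0 x).indicator (fun k => ENNReal.ofReal ((x - k) * deriv (deriv Φ) k)) k := by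
      intro k
      rw [taylorKernel_of_nonneg hx]
      by_cases hk : k ∈ Set.Ioc 0 x
      · rw [Set.indicator_of_mem hk, Set.indicator_of_mem hk, mul_comm]
      · rw [Set.indicator_of_notMem hk, Set.indicator_of_notMem hk, mul_zero, ENNReal.ofReal_zero]
    simp_rw [e]
    rw [lintegral_indicator measurableSet_Ioc, ← ofReal_integral_eq_lintegral_ofReal,
      ← intervalIntegral.integral_of_le hx, integral_taylor hΦ]
    · exact (intervalIntegrable_iff_integrableOn_Ioc_of_le hx).1
        (Continuous.intervalIntegrable (by fun_prop) _ _)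
    · filter_upwards [ae_restrict_mem measurableSet_Ioc] with k hk
      exact mul_nonneg (sub_nonneg.2 hk.2) (hnn k)
  · have e : ∀ k, ENNReal.ofReal (deriv (deriv Φ) k * taylorKernel k x) =
        (Set.Ioc x 0).indicator (fun k => ENNReal.ofReal ((k - x) * deriv (deriv Φ) k)) k := by
      intro k
      rw [taylorKernel_of_nonpos hx]
      by_cases hk : k ∈ Set.Ioc x 0
      · rw [Set.indicator_of_mem hk, Set.indicator_of_mem hk, mul_comm]
      · rw [Set.indicator_of_notMem hk, Set.indicator_of_notMem hk, mul_zero, ENNReal.ofReal_zero]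
    simp_rw [e]
    rw [lintegral_indicator measurableSet_Ioc, ← ofReal_integral_eq_lintegral_ofReal,
      ← intervalIntegral.integral_of_le hx, ← integral_taylor hΦ, intervalIntegral.integral_symm,
      ← intervalIntegral.integral_neg]
    · congr 2; funext k; ring
    · exact (intervalIntegrable_iff_integrableOn_Ioc_of_le hx).1
        (Continuous.intervalIntegrable (by fun_prop) _ _)
    · filter_upwards [ae_restrict_mem measurableSet_Ioc] with k hk
      exact mul_nonneg (sub_nonneg.2 hk.1.le) (hnn k)

variable {α : Type*} [MeasurableSpace α] {μ : Measure α} [IsFiniteMeasure μ]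

/-- Tonelli's theorem exchanges the two integrals. Working with extended nonnegative values avoids
assuming that `Φ ∘ v` is integrable, which for the solution is part of the conclusion. -/
lemma lintegral_comp_eq_lintegral_taylorKernel (hΦ : ContDiff ℝ ∞ Φ)
    (hc : ConvexOn ℝ Set.univ Φ) {v : α → ℝ} (hv : Integrable v μ) :
    ∫⁻ x, ENNReal.ofReal (Φ (v x) - Φ 0 - deriv Φ 0 * v x) ∂μ =
      ∫⁻ k, ENNReal.ofReal (deriv (deriv Φ) k) *
        ENNReal.ofReal (∫ x, taylorKernel k (v x) ∂μ) := by
  have h3 := (contDiff_deriv (contDiff_deriv hΦ)).continuous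
  have hK : AEMeasurable (fun z : α × ℝ => taylorKernel z.2 (v z.1)) (μ.prod volume) :=
    measurable_taylorKernel.comp_aemeasurable
      (measurable_snd.aemeasurable.prodMk hv.aemeasurable.comp_fst)
  have hΦm : Measurable fun k => ENNReal.ofReal (deriv (deriv Φ) k) :=
    h3.measurable.ennreal_ofReal
  simp_rw [← lintegral_taylorKernel hΦ hc]
  rw [lintegral_lintegral_swap]
  · refine lintegral_congr fun k => ?_
    rw [lintegral_const_mul' _ _ ENNReal.ofReal_ne_top, ofReal_integral_eq_lintegral_ofReal]
    · unfold taylorKernel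
      refine Integrable.div_const (Integrable.add ?_ ?_) 2
      · exact (hv.sub (integrable_const k)).abs.sub (integrable_const _)
      · split_ifs
        · exact hv
        · exact hv.neg
    · exact Eventually.of_forall fun x => taylorKernel_nonneg _ _
  · exact (hΦm.comp measurable_snd).aemeasurable.mul hK.ennreal_ofReal

/-- Convex ordering from the elementary inequalities `∫ |p - k| ≤ ∫ |g - k|`. -/
theorem integral_convex_comp_le {p g : α → ℝ} (hp : Integrable p μ) (hg : Integrable g μ)
    (hmean : ∫ x, p x ∂μ = ∫ x, g x ∂μ)
    (hpg : ∀ k : ℝ, ∫ x, |p x - k| ∂μ ≤ ∫ x, |g x - k| ∂μ)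
    (hΦ : ContDiff ℝ ∞ Φ) (hc : ConvexOn ℝ Set.univ Φ) (hi : Integrable (fun x => Φ (g x)) μ) :
    Integrable (fun x => Φ (p x)) μ ∧ ∫ x, Φ (p x) ∂μ ≤ ∫ x, Φ (g x) ∂μ := by
  -- The integrated kernel depends on `v` only through `∫ |v - k|` and the mean, the two quantities
  -- that the hypotheses compare.
  have hkernel : ∀ k {v : α → ℝ}, Integrable v μ → ∫ x, taylorKernel k (v x) ∂μ =
      ((∫ x, |v x - k| ∂μ) - (∫ _, |k| ∂μ) +
        (if 0 < k then ∫ x, v x ∂μ else -∫ x, v x ∂μ)) / 2 := fun k v hv => by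
    have i1 : Integrable (fun x => |v x - k|) μ := (hv.sub (integrable_const k)).abs
    have i2 : Integrable (fun x => |v x - k| - |k|) μ := i1.sub (integrable_const _)
    unfold taylorKernel
    split_ifs
    · rw [integral_div, integral_add i2 hv, integral_sub i1 (integrable_const _)]
    · have i3 : Integrable (fun x => -v x) μ := hv.neg
      rw [integral_div, integral_add i2 i3, integral_sub i1 (integrable_const _), integral_neg]
  have hle : ∫⁻ x, ENNReal.ofReal (Φ (p x) - Φ 0 - deriv Φ 0 * p x) ∂μ ≤
      ∫⁻ x, ENNReal.ofReal (Φ (g x) - Φ 0 - deriv Φ 0 * g x) ∂μ := by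
    rw [lintegral_comp_eq_lintegral_taylorKernel hΦ hc hp,
      lintegral_comp_eq_lintegral_taylorKernel hΦ hc hg]
    refine lintegral_mono fun k => mul_le_mul_right (ENNReal.ofReal_le_ofReal ?_) _
    rw [hkernel k hp, hkernel k hg, hmean]
    linarith [hpg k]
  have hnn : ∀ x, 0 ≤ Φ x - Φ 0 - deriv Φ 0 * x := fun x => by
    rw [← integral_taylor hΦ]
    have hd := deriv_deriv_nonneg hΦ hc
    rcases le_total 0 x with hx | hx
    · exact intervalIntegral.integral_nonneg hx fun k hk =>
        mul_nonneg (sub_nonneg.2 hk.2) (hd k)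
    · rw [intervalIntegral.integral_symm, ← intervalIntegral.integral_neg]
      exact intervalIntegral.integral_nonneg hx fun k hk => by
        nlinarith [mul_nonneg (sub_nonneg.2 hk.1) (hd k)]
  have hig : Integrable (fun x => Φ (g x) - Φ 0 - deriv Φ 0 * g x) μ :=
    (hi.sub (integrable_const _)).sub (hg.const_mul _)
  have hip : Integrable (fun x => Φ (p x) - Φ 0 - deriv Φ 0 * p x) μ := by
    refine ⟨?_, ?_⟩
    · have : Continuous fun x => Φ x - Φ 0 - deriv Φ 0 * x := by
        have := hΦ.continuous
        fun_prop
      exact this.comp_aestronglyMeasurable hp.aestronglyMeasurable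
    · rw [hasFiniteIntegral_iff_ofReal (Eventually.of_forall fun x => hnn _)]
      refine hle.trans_lt ?_
      rw [← hasFiniteIntegral_iff_ofReal (Eventually.of_forall fun x => hnn _)]
      exact hig.2
  have hip' : Integrable (fun x => Φ (p x)) μ := by
    have := (hip.add (integrable_const (Φ 0))).add (hp.const_mul (deriv Φ 0))
    refine this.congr (Eventually.of_forall fun x => ?_)
    simp only [Pi.add_apply]
    ring
  refine ⟨hip', ?_⟩
  have hreal : ∫ x, (Φ (p x) - Φ 0 - deriv Φ 0 * p x) ∂μ ≤
      ∫ x, (Φ (g x) - Φ 0 - deriv Φ 0 * g x) ∂μ := by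
    rw [integral_eq_lintegral_of_nonneg_ae (Eventually.of_forall fun x => hnn _) hip.1,
      integral_eq_lintegral_of_nonneg_ae (Eventually.of_forall fun x => hnn _) hig.1]
    refine ENNReal.toReal_mono ?_ hle
    have := hig.2
    rw [hasFiniteIntegral_iff_ofReal (Eventually.of_forall fun x => hnn _)] at this
    exact this.ne
  have e : ∀ {v : α → ℝ}, Integrable v μ → Integrable (fun x => Φ (v x)) μ →
      ∫ x, (Φ (v x) - Φ 0 - deriv Φ 0 * v x) ∂μ =
        ∫ x, Φ (v x) ∂μ - (∫ _, Φ 0 ∂μ) - deriv Φ 0 * ∫ x, v x ∂μ := fun {v} hv hv' => by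
    have i1 : Integrable (fun x => Φ (v x) - Φ 0) μ := hv'.sub (integrable_const _)
    rw [integral_sub i1 (hv.const_mul _), integral_sub hv' (integrable_const _),
      integral_const_mul]
  rw [e hp hip', e hg hi, hmean] at hreal
  linarith

end Taylor

/-! ### Construction of a superlinear convex function -/

/-- A smooth approximation of the positive part. -/
noncomputable def smoothPosPart (t : ℝ) : ℝ := ∫ r in (0 : ℝ)..t, Real.smoothTransition r

lemma hasDerivAt_smoothPosPart (t : ℝ) : HasDerivAt smoothPosPart (Real.smoothTransition t) t :=
  intervalIntegral.integral_hasDerivAt_right (Real.smoothTransition.continuous.intervalIntegrable _ _)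
    Real.smoothTransition.continuous.stronglyMeasurable.stronglyMeasurableAtFilter
    Real.smoothTransition.continuousAt

lemma deriv_smoothPosPart : deriv smoothPosPart = Real.smoothTransition :=
  funext fun t => (hasDerivAt_smoothPosPart t).deriv

lemma differentiable_smoothPosPart : Differentiable ℝ smoothPosPart :=
  fun t => (hasDerivAt_smoothPosPart t).differentiableAt

lemma contDiff_smoothPosPart : ContDiff ℝ ∞ smoothPosPart := by
  rw [contDiff_infty_iff_deriv, deriv_smoothPosPart]
  exact ⟨differentiable_smoothPosPart, Real.smoothTransition.contDiff⟩

lemma monotone_smoothPosPart : Monotone smoothPosPart :=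
  monotone_of_deriv_nonneg differentiable_smoothPosPart fun t => by
    rw [deriv_smoothPosPart]; exact Real.smoothTransition.nonneg t

lemma convexOn_smoothPosPart : ConvexOn ℝ Set.univ smoothPosPart :=
  Monotone.convexOn_univ_of_deriv differentiable_smoothPosPart <| by
    rw [deriv_smoothPosPart]; exact Real.smoothTransition.monotone

lemma smoothPosPart_of_nonpos {t : ℝ} (ht : t ≤ 0) : smoothPosPart t = 0 := by
  rw [smoothPosPart, intervalIntegral.integral_symm, neg_eq_zero]
  refine (intervalIntegral.integral_congr (g := fun _ => 0) fun r hr => ?_).trans (by simp)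
  rw [Set.uIcc_of_le ht] at hr
  exact Real.smoothTransition.zero_of_nonpos hr.2

lemma smoothPosPart_nonneg (t : ℝ) : 0 ≤ smoothPosPart t := by
  rcases le_total t 0 with ht | ht
  · rw [smoothPosPart_of_nonpos ht]
  · rw [← smoothPosPart_of_nonpos le_rfl]; exact monotone_smoothPosPart ht

lemma smoothPosPart_le {t : ℝ} (ht : 0 ≤ t) : smoothPosPart t ≤ t := by
  have := intervalIntegral.integral_mono_on ht
    (Real.smoothTransition.continuous.intervalIntegrable 0 t)
    (intervalIntegrable_const (μ := volume) (c := (1 : ℝ))) fun r _ => Real.smoothTransition.le_one r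
  simpa [smoothPosPart] using this

lemma sub_one_le_smoothPosPart (t : ℝ) : t - 1 ≤ smoothPosPart t := by
  rcases le_total t 1 with ht | ht
  · linarith [smoothPosPart_nonneg t]
  · have h1 : smoothPosPart t = smoothPosPart 1 + ∫ r in (1 : ℝ)..t, Real.smoothTransition r :=
      (intervalIntegral.integral_add_adjacent_intervals
        (Real.smoothTransition.continuous.intervalIntegrable 0 1)
        (Real.smoothTransition.continuous.intervalIntegrable 1 t)).symm
    have h2 : ∫ r in (1 : ℝ)..t, Real.smoothTransition r = t - 1 := by
      refine (intervalIntegral.integral_congr (g := fun _ => 1) fun r hr => ?_).trans (by simp)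
      rw [Set.uIcc_of_le ht] at hr
      exact Real.smoothTransition.one_of_one_le hr.1
    rw [h1, h2]
    linarith [smoothPosPart_nonneg 1]

/-- A smooth convex approximation of `(|t| - a)⁺`. -/
noncomputable def smoothExcess (a t : ℝ) : ℝ := smoothPosPart (t - a) + smoothPosPart (-t - a)

lemma contDiff_smoothExcess (a : ℝ) : ContDiff ℝ ∞ (smoothExcess a) :=
  (contDiff_smoothPosPart.comp (contDiff_id.sub contDiff_const)).add
    (contDiff_smoothPosPart.comp (contDiff_id.neg.sub contDiff_const))

lemma convexOn_smoothExcess (a : ℝ) : ConvexOn ℝ Set.univ (smoothExcess a) := by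
  refine ⟨convex_univ, fun x _ y _ b c hb hc hbc => ?_⟩
  have h1 := convexOn_smoothPosPart.2 (Set.mem_univ (x - a)) (Set.mem_univ (y - a)) hb hc hbc
  have h2 := convexOn_smoothPosPart.2 (Set.mem_univ (-x - a)) (Set.mem_univ (-y - a)) hb hc hbc
  simp only [smul_eq_mul] at h1 h2 ⊢
  have e1 : b * (x - a) + c * (y - a) = b * x + c * y - a := by linear_combination (-a) * hbc
  have e2 : b * (-x - a) + c * (-y - a) = -(b * x + c * y) - a := by
    linear_combination (-a) * hbc
  rw [e1] at h1
  rw [e2] at h2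
  simp only [smoothExcess]
  linarith

lemma smoothExcess_nonneg (a t : ℝ) : 0 ≤ smoothExcess a t :=
  add_nonneg (smoothPosPart_nonneg _) (smoothPosPart_nonneg _)

lemma smoothExcess_eq_zero {a t : ℝ} (h : |t| ≤ a) : smoothExcess a t = 0 := by
  have := abs_le.1 h
  rw [smoothExcess, smoothPosPart_of_nonpos (by linarith), smoothPosPart_of_nonpos (by linarith),
    add_zero]

lemma smoothExcess_le {a t : ℝ} (ha : 0 ≤ a) : smoothExcess a t ≤ |t| := by
  rcases le_total |t| a with h | h
  · rw [smoothExcess_eq_zero h]; exact abs_nonneg t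
  · rcases le_total 0 t with ht | ht
    · rw [abs_of_nonneg ht] at h ⊢
      rw [smoothExcess, smoothPosPart_of_nonpos (t := -t - a) (by linarith), add_zero]
      linarith [smoothPosPart_le (t := t - a) (by linarith)]
    · rw [abs_of_nonpos ht] at h ⊢
      rw [smoothExcess, smoothPosPart_of_nonpos (t := t - a) (by linarith), zero_add]
      linarith [smoothPosPart_le (t := -t - a) (by linarith)]

lemma sub_sub_one_le_smoothExcess (a t : ℝ) : |t| - a - 1 ≤ smoothExcess a t := by
  have h1 := sub_one_le_smoothPosPart (t - a)
  have h2 := sub_one_le_smoothPosPart (-t - a)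
  have h3 := smoothPosPart_nonneg (t - a)
  have h4 := smoothPosPart_nonneg (-t - a)
  rcases abs_cases t with ⟨h, -⟩ | ⟨h, -⟩ <;> rw [h, smoothExcess] <;> linarith

/-- The de la Vallée-Poussin criterion, for a single integrable function. -/
theorem exists_isSuperlinearFor {g : UnitAddCircle → ℝ} (hg : Integrable g) :
    ∃ Φ, IsSuperlinearFor Φ g := by
  have hmeas : ∀ a, AEStronglyMeasurable (fun x => smoothExcess a (g x)) volume := fun a =>
    (contDiff_smoothExcess a).continuous.comp_aestronglyMeasurable hg.aestronglyMeasurable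
  have hbd : ∀ n : ℕ, ∀ x, ‖smoothExcess n (g x)‖ ≤ |g x| := fun n x => by
    rw [Real.norm_eq_abs, abs_of_nonneg (smoothExcess_nonneg _ _)]
    exact smoothExcess_le n.cast_nonneg
  have hint : ∀ n : ℕ, Integrable fun x => smoothExcess n (g x) := fun n =>
    hg.abs.mono' (hmeas n) (Eventually.of_forall (hbd n))
  have hlim : Tendsto (fun n : ℕ => ∫ x, smoothExcess n (g x)) atTop (𝓝 0) := by
    have := tendsto_integral_of_dominated_convergence (f := fun _ => (0 : ℝ))
      (fun x => |g x|) (fun n : ℕ => hmeas n) hg.abs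
      (fun n => Eventually.of_forall (hbd n)) (Eventually.of_forall fun x => ?_)
    · simpa using this
    · refine tendsto_const_nhds.congr' ?_
      filter_upwards [tendsto_natCast_atTop_atTop.eventually_ge_atTop |g x|] with n hn
      exact (smoothExcess_eq_zero hn).symm
  -- The bound `(1 / 2) ^ n` makes the sum of the excesses integrable. The requirement `n ≤ a` makes
  -- the sum finite on each bounded set, so smoothness and convexity are inherited from finite sums.
  have hex : ∀ n : ℕ, ∃ a : ℕ, n ≤ a ∧ ∫ x, smoothExcess a (g x) ≤ (1 / 2) ^ n := fun n => by
    have h1 := hlim.eventually (eventually_le_nhds (by positivity : (0 : ℝ) < (1 / 2) ^ n))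
    obtain ⟨a, ha, hna⟩ := (h1.and (eventually_ge_atTop n)).exists
    exact ⟨a, hna, ha⟩
  choose a ha hai using hex
  have hzero : ∀ (N : ℕ) (t : ℝ), |t| ≤ N → ∀ n ∉ Finset.range N, smoothExcess (a n) t = 0 :=
    fun N t ht n hn => by
      rw [Finset.mem_range, not_lt] at hn
      exact smoothExcess_eq_zero (ht.trans (by exact_mod_cast hn.trans (ha n)))
  have hsum : ∀ (N : ℕ) (t : ℝ), |t| ≤ N →
      ∑' n, smoothExcess (a n) t = ∑ n ∈ Finset.range N, smoothExcess (a n) t :=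
    fun N t ht => tsum_eq_sum (hzero N t ht)
  have hsummable : ∀ t : ℝ, Summable fun n => smoothExcess (a n) t := fun t => by
    obtain ⟨N, hN⟩ := exists_nat_ge |t|
    exact summable_of_ne_finset_zero (hzero N t hN)
  refine ⟨fun t => ∑' n, smoothExcess (a n) t, ?_, ?_, ?_, ?_⟩
  · rw [contDiff_iff_contDiffAt]
    intro t
    obtain ⟨N, hN⟩ := exists_nat_gt |t|
    have h1 : ContDiff ℝ ∞ fun t => ∑ n ∈ Finset.range N, smoothExcess (a n) t :=
      ContDiff.sum fun n _ => contDiff_smoothExcess _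
    refine h1.contDiffAt.congr_of_eventuallyEq ?_
    filter_upwards [continuous_abs.continuousAt.eventually (eventually_lt_nhds hN)] with s hs
    exact hsum N s hs.le
  · refine ⟨convex_univ, fun x _ y _ b c hb hc hbc => ?_⟩
    obtain ⟨N, hN⟩ := exists_nat_ge (max |x| |y|)
    have hx := (le_max_left _ _).trans hN
    have hy := (le_max_right _ _).trans hN
    have hxy : |b • x + c • y| ≤ N := by
      have := convex_Icc (-(N : ℝ)) N (abs_le.1 hx) (abs_le.1 hy) hb hc hbc
      exact abs_le.2 this
    simp only
    rw [hsum N _ hx, hsum N _ hy, hsum N _ hxy, Finset.smul_sum, Finset.smul_sum,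
      ← Finset.sum_add_distrib]
    exact Finset.sum_le_sum fun n _ =>
      (convexOn_smoothExcess (a n)).2 (Set.mem_univ x) (Set.mem_univ y) hb hc hbc
  · rw [tendsto_atTop]
    intro M
    -- The first `m` terms give at least `m |t|` minus a constant; once `|t|` exceeds that constant,
    -- at least `(m - 1) |t| ≥ M |t|` remains.
    obtain ⟨m, hm⟩ := exists_nat_ge (M + 1)
    have hev := (tendsto_norm_cocompact_atTop (E := ℝ)).eventually_ge_atTop
      (max 1 (∑ n ∈ Finset.range m, ((a n : ℝ) + 1)))
    filter_upwards [hev] with t ht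
    rw [Real.norm_eq_abs] at ht
    have h1 : 1 ≤ |t| := (le_max_left _ _).trans ht
    have h2 := (le_max_right _ _).trans ht
    rw [le_div_iff₀ (by linarith)]
    have h3 : ∑ n ∈ Finset.range m, (|t| - ((a n : ℝ) + 1)) ≤ ∑' n, smoothExcess (a n) t := by
      refine le_trans (Finset.sum_le_sum fun n _ => ?_)
        ((hsummable t).sum_le_tsum _ fun n _ => smoothExcess_nonneg _ _)
      linarith [sub_sub_one_le_smoothExcess (a n) t]
    rw [Finset.sum_sub_distrib, Finset.sum_const, Finset.card_range, nsmul_eq_mul] at h3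
    nlinarith
  · have hnn : ∀ x, 0 ≤ ∑' n, smoothExcess (a n) (g x) := fun x =>
      tsum_nonneg fun n => smoothExcess_nonneg _ _
    have hofReal : ∀ x, ENNReal.ofReal (∑' n, smoothExcess (a n) (g x)) =
        ∑' n, ENNReal.ofReal (smoothExcess (a n) (g x)) := fun x =>
      ENNReal.ofReal_tsum_of_nonneg (fun n => smoothExcess_nonneg _ _) (hsummable _)
    refine ⟨?_, ?_⟩
    · have : AEMeasurable (fun x => ∑' n, ENNReal.ofReal (smoothExcess (a n) (g x))) volume :=
        AEMeasurable.tsum fun n => (hmeas _).aemeasurable.ennreal_ofReal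
      refine (this.ennreal_toReal.congr (Eventually.of_forall fun x => ?_)).aestronglyMeasurable
      simp only
      rw [← hofReal, ENNReal.toReal_ofReal (hnn x)]
    · rw [hasFiniteIntegral_iff_ofReal (Eventually.of_forall hnn)]
      simp_rw [hofReal]
      rw [lintegral_tsum fun n => (hmeas _).aemeasurable.ennreal_ofReal]
      have h1 : ∀ n, ∫⁻ x, ENNReal.ofReal (smoothExcess (a n) (g x)) ≤
          ENNReal.ofReal ((1 / 2) ^ n) := fun n => by
        rw [← ofReal_integral_eq_lintegral_ofReal (hint (a n))
          (Eventually.of_forall fun x => smoothExcess_nonneg _ _)]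
        exact ENNReal.ofReal_le_ofReal (hai n)
      refine (ENNReal.tsum_le_tsum h1).trans_lt ?_
      rw [← ENNReal.ofReal_tsum_of_nonneg (fun n => by positivity) summable_geometric_two]
      exact ENNReal.ofReal_lt_top

/-! ### Uniqueness and conclusion -/

lemma sub_mul_sub_nonneg_of_mem_subdifferential {W : ℝ → ℝ} {p q s t : ℝ}
    (hs : s ∈ subdifferential W p) (ht : t ∈ subdifferential W q) : 0 ≤ (s - t) * (p - q) := by
  have h1 := hs q
  have h2 := ht p
  linarith

/-- The weak equation says that `(u - f) / h` is the weak derivative of the flux. -/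
lemma hasWeakDeriv_flux {h : ℝ} {f u ξ : UnitAddCircle → ℝ} (hf : Integrable f)
    (hu : Integrable u) (hξ : Integrable ξ)
    (heq : ∀ φ, IsTorusSmooth φ → ∫ x, ((1 / h) * (u x - f x) * φ x + ξ x * torusDeriv φ x) = 0) :
    HasWeakDeriv ξ (fun x => (1 / h) * (u x - f x)) := by
  intro φ hφ
  have h1 := heq φ hφ
  have hi : Integrable fun x => (1 / h) * (u x - f x) := (hu.sub hf).const_mul _
  rw [integral_add (hi.mul_continuous hφ.continuous) (hξ.mul_continuous hφ.continuous_torusDeriv)] at h1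
  exact eq_neg_of_add_eq_zero_right h1

/-- The equations are subtracted and tested with `u - v`: `(1/h) ∫ (u - v)²` equals minus the
integral of the flux difference times `ux - vx`, which is nonnegative by monotonicity of the
subdifferential. Absolutely continuous representatives justify this integration by parts, as `u - v`
need not be a smooth test function. -/
lemma IsWeakSolution.ae_eq {W : ℝ → ℝ} {h : ℝ} (hh : 0 < h) {f u ux v vx : UnitAddCircle → ℝ}
    (hf : Integrable f) (hu : IsWeakSolution W h f u ux) (hv : IsWeakSolution W h f v vx) :
    v =ᵐ[volume] u ∧ vx =ᵐ[volume] ux := by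
  obtain ⟨ξ, -, hξ, -, -, hξW, hξeq⟩ := hu.exists_flux
  obtain ⟨ζ, -, hζ, -, -, hζW, hζeq⟩ := hv.exists_flux
  have hui := hu.isW11.integrable
  have hvi := hv.isW11.integrable
  have hξi : Integrable ξ := hξ.integrable le_top
  have hζi : Integrable ζ := hζ.integrable le_top
  have hX : IsW11 (fun x => ξ x - ζ x) (fun x => (1 / h) * (u x - f x) - (1 / h) * (v x - f x)) :=
    ⟨hξi.sub hζi, ((hui.sub hf).const_mul _).sub ((hvi.sub hf).const_mul _),
      (hasWeakDeriv_flux hf hui hξi hξeq).sub (hasWeakDeriv_flux hf hvi hζi hζeq) hξi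
        ((hui.sub hf).const_mul _) hζi ((hvi.sub hf).const_mul _)⟩
  have hD : IsW11 (fun x => u x - v x) (fun x => ux x - vx x) :=
    ⟨hui.sub hvi, hu.isW11.integrable_deriv.sub hv.isW11.integrable_deriv,
      hu.isW11.hasWeakDeriv.sub hv.isW11.hasWeakDeriv hui hu.isW11.integrable_deriv hvi
        hv.isW11.integrable_deriv⟩
  obtain ⟨X, -, hXe, hXp⟩ := hX.exists_isPrimitive
  obtain ⟨D, hDc, hDe, hDp⟩ := hD.exists_isPrimitive
  have hibp := hXp.integral_mul_eq_neg hDp (periodic_comp_coe X) (periodic_comp_coe D)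
  rw [← torus_integral_eq fun x => ((1 / h) * (u x - f x) - (1 / h) * (v x - f x)) * D x,
    ← torus_integral_eq fun x => X x * (ux x - vx x)] at hibp
  have h1 : ∫ x, ((1 / h) * (u x - f x) - (1 / h) * (v x - f x)) * D x =
      (1 / h) * ∫ x, D x ^ 2 := by
    rw [← integral_const_mul]
    refine integral_congr_ae ?_
    filter_upwards [hDe] with x hx
    rw [hx]; ring
  have h2 : 0 ≤ ∫ x, X x * (ux x - vx x) := by
    refine integral_nonneg_of_ae ?_
    filter_upwards [hXe, hξW, hζW] with x hx h3 h4
    rw [hx]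
    exact sub_mul_sub_nonneg_of_mem_subdifferential h3 h4
  have h3 : ∫ x, D x ^ 2 = 0 := by
    refine le_antisymm ?_ (integral_nonneg fun x => sq_nonneg _)
    refine le_of_mul_le_mul_left ?_ (one_div_pos.2 hh)
    rw [← h1, hibp, mul_zero]
    linarith
  have h4 := (integral_eq_zero_iff_of_nonneg (fun x => sq_nonneg (D x))
    (integrable_of_continuous (hDc.pow 2))).1 h3
  have huv : v =ᵐ[volume] u := by
    filter_upwards [h4, hDe] with x hx hx'
    have h5 : D x = 0 := pow_eq_zero_iff two_ne_zero |>.1 hx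
    linarith
  exact ⟨huv, (hv.isW11.hasWeakDeriv.congr_left huv).ae_unique hu.isW11.hasWeakDeriv
    hv.isW11.integrable_deriv hu.isW11.integrable_deriv⟩

/-- Existence of a weak solution, with the elementary `L¹` estimates for its derivative. -/
theorem exists_isWeakSolution {W : ℝ → ℝ} (hW : ConvexOn ℝ Set.univ W) (hgrowth : HasLinearGrowth W)
    {f fx : UnitAddCircle → ℝ} (hf : IsW11 f fx) {h : ℝ} (hh : 0 < h) :
    ∃ u ux, IsWeakSolution W h f u ux ∧ ∀ c : ℝ, ∫ x, |ux x - c| ≤ ∫ x, |fx x - c| := by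
  obtain ⟨L, -, hL⟩ := hW.exists_lipschitz_of_hasLinearGrowth hgrowth
  obtain ⟨F, hFc, hFf, hF⟩ := hf.exists_isPrimitive
  obtain ⟨u, p, ξ, hu, hξc, hξ, ⟨C, hC⟩, hsub, hp⟩ :=
    exists_solution hW hL hh hFc hf.integrable_deriv hF
  -- The flux derivative is written with the continuous representative `F` of `f`; it is essentially
  -- bounded, hence square integrable on the circle.
  refine ⟨u, p, ⟨hu, ξ, fun x => (u x - F x) / h, ?_, ?_, hξ, hsub, fun φ hφ => ?_⟩, hp⟩
  · obtain ⟨M, hM⟩ := isCompact_univ.exists_bound_of_continuousOn hξc.continuousOn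
    exact memLp_top_of_bound hξc.aestronglyMeasurable M (Eventually.of_forall fun x => hM x trivial)
  · refine MemLp.of_bound
      ((hu.integrable.sub (integrable_of_continuous hFc)).div_const h).aestronglyMeasurable (C / h) ?_
    filter_upwards [hC] with x hx
    rw [Real.norm_eq_abs, abs_div, abs_of_pos hh]
    exact div_le_div_of_nonneg_right hx hh.le
  · have hi : Integrable fun x => (1 / h) * (u x - f x) :=
      (hu.integrable.sub hf.integrable).const_mul _
    rw [integral_add (hi.mul_continuous hφ.continuous)
      ((integrable_of_continuous hξc).mul_continuous hφ.continuous_torusDeriv),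
      hξ φ hφ, ← sub_eq_add_neg, sub_eq_zero]
    refine integral_congr_ae ?_
    filter_upwards [hFf] with x hx
    rw [hx]; ring

theorem theorem2 (W : ℝ → ℝ) (hW : ConvexOn ℝ Set.univ W) (hgrowth : HasLinearGrowth W)
    (f fx : UnitAddCircle → ℝ) (hf : IsW11 f fx) (h : ℝ) (hh : 0 < h) :
    ∃ u ux : UnitAddCircle → ℝ,
      -- existence
      IsWeakSolution W h f u ux ∧
      -- uniqueness, as elements of the Sobolev space
      (∀ v vx : UnitAddCircle → ℝ, IsWeakSolution W h f v vx →
        v =ᵐ[volume] u ∧ vx =ᵐ[volume] ux) ∧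
      -- there is a superlinear function for the derivative of `f`, and each one gives an estimate
      (∃ Φ : ℝ → ℝ, IsSuperlinearFor Φ fx) ∧
      ∀ Φ : ℝ → ℝ, IsSuperlinearFor Φ fx →
        Integrable (fun x => Φ (ux x)) ∧ ∫ x, Φ (ux x) ≤ ∫ x, Φ (fx x) := by
  obtain ⟨u, ux, hu, hc⟩ := exists_isWeakSolution hW hgrowth hf hh
  refine ⟨u, ux, hu, fun v vx hv => hu.ae_eq hh hf.integrable hv,
    exists_isSuperlinearFor hf.integrable_deriv, fun Φ hΦ => ?_⟩
  refine integral_convex_comp_le hu.isW11.integrable_deriv hf.integrable_deriv ?_ hc hΦ.smooth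
    hΦ.convex hΦ.integrable
  -- Weak derivatives on the circle have mean zero, which gives the equality of means required by
  -- the convex ordering.
  rw [integral_eq_zero_of_hasWeakDeriv hu.isW11.hasWeakDeriv,
    integral_eq_zero_of_hasWeakDeriv hf.hasWeakDeriv]
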